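/- **Setting.** Let $\mathcal X\subset\mathbb R^d$ be compact, let $\rho$ be a Borel probability measure on $\mathcal X$, and let $K_0,K_1:\mathcal X\times\mathcal X\to\mathbb R$ be continuous, symmetric, positive semidefinite kernels. Write $\kappa_i=\sup_{x,y\in\mathcal X}|K_i(x,y)|$, and write $K_i$ also for the covariance operator $[K_i\phi](x)=\int_{\mathcal X}K_i(x,s)\phi(s)\,d\rho(s)$ on the real Hilbert space $L^2(\mathcal X,\rho)$. Let $\epsilon>0$. The entropy-regularized squared 2-Wasserstein distance between the covariance operators is $$W_{2,\epsilon}^2(K_0,K_1)=\mathrm{Tr}[K_0]+\mathrm{Tr}[K_1]+\tfrac{\epsilon}{2}\log\det\!\big(I+\tfrac12 M_\epsilon\big)-\tfrac{\epsilon}{2}\mathrm{Tr}[M_\epsilon],\qquad M_\epsilon=-I+\Big(I+\tfrac{16}{\epsilon^2}K_0^{1/2}K_1K_0^{1/2}\Big)^{1/2},$$ where the square roots are those of positive operators, $\mathrm{Tr}$ is the operator trace and $\det$ the Fredholm determinant. For $n\ge 1$ and points $x_1,\dots,x_n\in\mathcal X$ let $\Sigma_{i}$ be the $n\times n$ matrix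 $(\Sigma_{i})_{jk}=\frac1nK_i(x_j,x_k)$, and put $$W_{2,\epsilon}^2(K_0,K_1,n)=\mathrm{Tr}[\Sigma_0+\Sigma_1]-\tfrac{\epsilon}{2}F\!\Big(\tfrac{16}{\epsilon^2}\Sigma_0\Sigma_1\Big),\qquad F(A)=\mathrm{Tr}\big[-I+(I+A)^{1/2}\big]-\log\det\!\big(\tfrac12I+\tfrac12(I+A)^{1/2}\big),$$ where $(I+A)^{1/2}$ is the principal square root. **Theorem (Entropic Wasserstein Error Concentration).** Let $n\geq 1$, let $x_1,\dots,x_n$ be independent random points with law $\rho$, and let $\theta\ge 0$. Then, with probability at least $1-6e^{-\theta}$, $$\left|W_{2,\epsilon}^2(K_0,K_1)-W_{2,\epsilon}^2(K_0,K_1,n)\right|\le\sqrt{\frac{\big(72(\kappa_0+\kappa_1)^2+288\,\epsilon^{-2}\kappa_0^2\kappa_1^2\big)\theta}{n}} .$$ -/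

import Mathlib

open MeasureTheory

noncomputable section

namespace EntropicGP

/-- Symmetric positive semidefinite kernels (covariance functions): every finite-dimensional
marginal `(K(x_i, x_j))_{ij}` is a symmetric positive semidefinite matrix. -/
def IsCovarianceKernel {X : Type*} [TopologicalSpace X] (K : C(X × X, ℝ)) : Prop :=
  ∀ (m : ℕ) (x : Fin m → X), (Matrix.of fun i j => K (x i, x j)).PosSemidef

/-- `κ = sup_{x,y} |K(x,y)|`. -/
def kernelSup {X : Type*} [TopologicalSpace X] (K : C(X × X, ℝ)) : ℝ :=
  ⨆ p : X × X, |K p|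

section Integral

variable {X : Type*} [MetricSpace X] [CompactSpace X] [MeasurableSpace X] [BorelSpace X]

theorem integrable_kernel_mul (ρ : Measure X) [IsProbabilityMeasure ρ] (K : C(X × X, ℝ))
    (φ : Lp ℝ 2 ρ) (x : X) : Integrable (fun s => K (x, s) * φ s) ρ := by
  have hφ : Integrable φ ρ := (Lp.memLp φ).integrable (by norm_num)
  refine hφ.bdd_mul (c := ‖K‖) ?_ ?_
  · exact (by fun_prop : Continuous fun s => K (x, s)).aestronglyMeasurable
  · exact Filter.Eventually.of_forall fun s => K.norm_coe_le_norm _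

theorem continuous_integral_kernel (ρ : Measure X) [IsProbabilityMeasure ρ] (K : C(X × X, ℝ))
    (φ : Lp ℝ 2 ρ) : Continuous fun x => ∫ s, K (x, s) * φ s ∂ρ := by
  have hφ : Integrable φ ρ := (Lp.memLp φ).integrable (by norm_num)
  refine continuous_of_dominated (bound := fun s => ‖K‖ * ‖φ s‖)
    (fun x => (integrable_kernel_mul ρ K φ x).aestronglyMeasurable) ?_
    (hφ.norm.const_mul _) ?_
  · intro x
    refine Filter.Eventually.of_forall fun s => ?_
    rw [norm_mul]
    gcongr
    exact K.norm_coe_le_norm _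
  · exact Filter.Eventually.of_forall fun s => by fun_prop

/-- The map `φ ↦ (x ↦ ∫ K(x,s) φ(s) dρ(s))` from `L²(X,ρ)` to continuous functions. -/
def integralMap (ρ : Measure X) [IsProbabilityMeasure ρ] (K : C(X × X, ℝ)) :
    Lp ℝ 2 ρ →ₗ[ℝ] C(X, ℝ) where
  toFun φ := ⟨fun x => ∫ s, K (x, s) * φ s ∂ρ, continuous_integral_kernel ρ K φ⟩
  map_add' φ ψ := by
    ext x
    simp only [ContinuousMap.coe_mk, ContinuousMap.add_apply]
    rw [← integral_add (integrable_kernel_mul ρ K φ x) (integrable_kernel_mul ρ K ψ x)]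
    refine integral_congr_ae ?_
    filter_upwards [Lp.coeFn_add φ ψ] with s hs
    rw [hs, Pi.add_apply, mul_add]
  map_smul' c φ := by
    ext x
    simp only [ContinuousMap.coe_mk, ContinuousMap.smul_apply, RingHom.id_apply, smul_eq_mul]
    rw [← integral_const_mul]
    refine integral_congr_ae ?_
    filter_upwards [Lp.coeFn_smul c φ] with s hs
    rw [hs, Pi.smul_apply, smul_eq_mul]
    ring

theorem norm_integralMap_le (ρ : Measure X) [IsProbabilityMeasure ρ] (K : C(X × X, ℝ))
    (φ : Lp ℝ 2 ρ) : ‖integralMap ρ K φ‖ ≤ ‖K‖ * ‖φ‖ := by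
  have hφ : Integrable φ ρ := (Lp.memLp φ).integrable (by norm_num)
  have h1 : ∫ s, ‖φ s‖ ∂ρ ≤ ‖φ‖ := by
    rw [integral_norm_eq_lintegral_enorm hφ.aestronglyMeasurable, Lp.norm_def,
      ← eLpNorm_one_eq_lintegral_enorm]
    exact ENNReal.toReal_mono (Lp.eLpNorm_ne_top φ)
      (eLpNorm_le_eLpNorm_of_exponent_le (by norm_num) hφ.aestronglyMeasurable)
  refine (ContinuousMap.norm_le _ (by positivity)).2 fun x => ?_
  calc ‖∫ s, K (x, s) * φ s ∂ρ‖ ≤ ∫ s, ‖K (x, s) * φ s‖ ∂ρ := norm_integral_le_integral_norm _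
    _ ≤ ∫ s, ‖K‖ * ‖φ s‖ ∂ρ := by
        refine integral_mono (integrable_kernel_mul ρ K φ x).norm (hφ.norm.const_mul _) fun s => ?_
        simp only [norm_mul]
        gcongr
        exact K.norm_coe_le_norm _
    _ = ‖K‖ * ∫ s, ‖φ s‖ ∂ρ := integral_const_mul _ _
    _ ≤ ‖K‖ * ‖φ‖ := by gcongr

/-- The covariance operator `[Kφ](x) = ∫ K(x,s) φ(s) dρ(s)` on `L²(X,ρ)`. -/
def covOp (ρ : Measure X) [IsProbabilityMeasure ρ] (K : C(X × X, ℝ)) :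
    Lp ℝ 2 ρ →L[ℝ] Lp ℝ 2 ρ :=
  (ContinuousMap.toLp 2 ρ ℝ).comp
    ((integralMap ρ K).mkContinuous ‖K‖ (norm_integralMap_le ρ K))

theorem covOp_apply_ae (ρ : Measure X) [IsProbabilityMeasure ρ] (K : C(X × X, ℝ))
    (φ : Lp ℝ 2 ρ) : ∀ᵐ x ∂ρ, covOp ρ K φ x = ∫ s, K (x, s) * φ s ∂ρ :=
  ContinuousMap.coeFn_toLp ρ (integralMap ρ K φ)

end Integral

section Operators

variable {H : Type*} [NormedAddCommGroup H] [InnerProductSpace ℝ H] [CompleteSpace H]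

open Classical in
/-- The square root `A^{1/2}` of a positive operator on a real Hilbert space: the positive
operator `R` with `R² = A` (it exists and is unique whenever `A` is positive). -/
def posSqrt (A : H →L[ℝ] H) : H →L[ℝ] H :=
  if h : ∃ R : H →L[ℝ] H, R.IsPositive ∧ R * R = A then h.choose else 0

/-- The trace `∑ₖ ⟨A eₖ, eₖ⟩` over an orthonormal (Hilbert) basis `(eₖ)`; for trace-class `A`
the sum converges absolutely and does not depend on the basis. -/
def opTrace (A : H →L[ℝ] H) : ℝ :=
  ∑' k : (exists_hilbertBasis ℝ H).choose,
    inner ℝ (A ((exists_hilbertBasis ℝ H).choose_spec.choose k))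
      ((exists_hilbertBasis ℝ H).choose_spec.choose k)

/-- The Fredholm determinant `det (I + A) = ∏ (1 + μ)` of a self-adjoint trace-class
operator `A`, the product running over the nonzero eigenvalues `μ` of `A` with multiplicity. -/
def detOneAdd (A : H →L[ℝ] H) : ℝ :=
  ∏' μ : {μ : ℝ // μ ≠ 0},
    (1 + (μ : ℝ)) ^ Module.finrank ℝ (Module.End.eigenspace (A : H →ₗ[ℝ] H) (μ : ℝ))

/-- `M_ε(A, B) = -I + (I + (16/ε²) A^{1/2} B A^{1/2})^{1/2}`. -/
def opM (ε : ℝ) (A B : H →L[ℝ] H) : H →L[ℝ] H :=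
  -1 + posSqrt (1 + (16 / ε ^ 2) • (posSqrt A * B * posSqrt A))

/-- The entropy-regularized squared 2-Wasserstein distance `W²_{2,ε}(A, B)` between the
covariance operators `A` and `B`. -/
def opW2 (ε : ℝ) (A B : H →L[ℝ] H) : ℝ :=
  opTrace A + opTrace B
    + ε / 2 * Real.log (detOneAdd ((1 / 2 : ℝ) • opM ε A B))
    - ε / 2 * opTrace (opM ε A B)

end Operators

section Empirical

open Classical in
/-- The principal square root `A^{1/2}` of a square matrix with no eigenvalue in `(-∞, 0]`:
the matrix `R` with `R² = A` all of whose complex eigenvalues have positive real part. -/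
def principalSqrt {n : ℕ} (A : Matrix (Fin n) (Fin n) ℝ) : Matrix (Fin n) (Fin n) ℝ :=
  if h : ∃ R : Matrix (Fin n) (Fin n) ℝ, R * R = A ∧
      ∀ z ∈ spectrum ℂ (R.map Complex.ofReal), 0 < z.re
  then h.choose else 0

/-- `F(A) = Tr[-I + (I + A)^{1/2}] - log det (½ I + ½ (I + A)^{1/2})`. -/
def matF {n : ℕ} (A : Matrix (Fin n) (Fin n) ℝ) : ℝ :=
  (-1 + principalSqrt (1 + A)).trace
    - Real.log ((1 / 2 : ℝ) • (1 : Matrix (Fin n) (Fin n) ℝ)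
        + (1 / 2 : ℝ) • principalSqrt (1 + A)).det

/-- `(Σ_K^{(n)})_{ij} = K(x_i, x_j) / n`. -/
def empCov {X : Type*} [TopologicalSpace X] {n : ℕ} (K : C(X × X, ℝ)) (x : Fin n → X) :
    Matrix (Fin n) (Fin n) ℝ :=
  Matrix.of fun i j => (1 / (n : ℝ)) * K (x i, x j)

/-- The estimator `W²_{2,ε}(K₀, K₁, n)
= Tr[Σ_{K₀}^{(n)} + Σ_{K₁}^{(n)}] - (ε/2) F((16/ε²) Σ_{K₀}^{(n)} Σ_{K₁}^{(n)})`. -/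
def empW2 {X : Type*} [TopologicalSpace X] {n : ℕ} (ε : ℝ) (K₀ K₁ : C(X × X, ℝ))
    (x : Fin n → X) : ℝ :=
  (empCov K₀ x + empCov K₁ x).trace
    - ε / 2 * matF ((16 / ε ^ 2) • (empCov K₀ x * empCov K₁ x))

end Empirical

end EntropicGP

end

/-! The kernels have continuous feature maps `φ₀`, `φ₁` into Hilbert spaces. Put G = ∫ φ₀ ⊗ φ₁ dρ,
an operator from H₁ to H₀, and let G_n be its average over the sample. Up to zero eigenvalues, G*G
has the spectrum of K₀^{1/2} K₁ K₀^{1/2}, and G_n*G_n that of Σ₀Σ₁. With f = `scalarF` and c =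
16/ε², both quantities therefore take one form: the mean of K₀(x,x) + K₁(x,x), minus (ε/2) Tr
f(cG*G), with ρ replaced by the empirical measure in the second (`exists_eigenbasis_opW2`,
`exists_eigenbasis_empW2`).

On [0, ∞), f is increasing and concave with slope at most 1/4, so a Klein-type inequality
(`hasSum_scalarF_le`) bounds the change of Tr f(cG*G) by (c/4)(‖G‖ + ‖G_n‖)‖G − G_n‖ in
Hilbert–Schmidt norms. Hence the error is at most a scalar deviation plus (4/ε) B times a
Hilbert-space deviation, where ‖φ₀ ⊗ φ₁‖ ≤ B = √(κ₀κ₁) (`abs_opW2_sub_empW2_le`).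

Both deviations are sample means minus expectations of bounded vectors. Pinelis' inequality
(`pi_norm_sum_gt_le`) controls each outside an event of probability 2e^{-θ}. The total failure
4e^{-θ} and the resulting constants are below those claimed. -/

namespace EntropicGP

open scoped ENNReal Topology
open Filter

/-! ### Scalar inequalities -/

/-- The scalar function `f(a) = √(1 + a) - 1 - log (½ + ½ √(1 + a))`. -/
noncomputable def scalarF (a : ℝ) : ℝ :=
  √(1 + a) - 1 - Real.log (1 / 2 + 1 / 2 * √(1 + a))

theorem one_le_sqrt_one_add {a : ℝ} (ha : 0 ≤ a) : 1 ≤ √(1 + a) :=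
  Real.one_le_sqrt.2 (by linarith)

theorem scalarF_zero : scalarF 0 = 0 := by
  simp [scalarF]; norm_num

theorem scalarF_nonneg {a : ℝ} (ha : 0 ≤ a) : 0 ≤ scalarF a := by
  have h := one_le_sqrt_one_add ha
  have := Real.log_le_sub_one_of_pos (show 0 < 1 / 2 + 1 / 2 * √(1 + a) by linarith)
  unfold scalarF; linarith

/-- `f` lies below its tangents, whose slopes are between `0` and `1/4`. -/
theorem exists_slope_scalarF {b : ℝ} (hb : 0 ≤ b) :
    ∃ m : ℝ, 0 ≤ m ∧ m ≤ 1 / 4 ∧ ∀ a, 0 ≤ a → scalarF a ≤ scalarF b + m * (a - b) := by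
  have hr := one_le_sqrt_one_add hb
  -- This is f'(b). In the variables s = √(1 + a), r = √(1 + b), the bound log t ≤ t − 1 at t = (1 +
  -- r)/(1 + s) leaves a gap with the sign of s − 1.
  refine ⟨1 / (2 * (1 + √(1 + b))), by positivity, ?_, fun a ha => ?_⟩
  · rw [div_le_div_iff₀ (by positivity) (by positivity)]; linarith
  have hs := one_le_sqrt_one_add ha
  have h1 : √(1 + a) ^ 2 = 1 + a := Real.sq_sqrt (by linarith)
  have h2 : √(1 + b) ^ 2 = 1 + b := Real.sq_sqrt (by linarith)
  rw [show a - b = √(1 + a) ^ 2 - √(1 + b) ^ 2 by rw [h1, h2]; ring]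
  unfold scalarF
  generalize √(1 + a) = s at *
  generalize √(1 + b) = r at *
  have h3 : Real.log (1 / 2 + 1 / 2 * r) - Real.log (1 / 2 + 1 / 2 * s) ≤ (r - s) / (1 + s) := by
    rw [← Real.log_div (by positivity) (by positivity)]
    refine (Real.log_le_sub_one_of_pos (by positivity)).trans (le_of_eq ?_)
    field_simp; ring
  have h4 : 1 / (2 * (1 + r)) * (s ^ 2 - r ^ 2) - ((s - r) + (r - s) / (1 + s))
      = (s - r) ^ 2 * (s - 1) / (2 * (1 + r) * (1 + s)) := by
    field_simp; ring
  have h5 : 0 ≤ (s - r) ^ 2 * (s - 1) / (2 * (1 + r) * (1 + s)) := by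
    have : 0 ≤ s - 1 := by linarith
    positivity
  linarith

theorem scalarF_le {a : ℝ} (ha : 0 ≤ a) : scalarF a ≤ a / 4 := by
  obtain ⟨m, hm, hm', h⟩ := exists_slope_scalarF le_rfl
  have := h a ha
  rw [scalarF_zero] at this
  nlinarith

/-- Convexity of `u ↦ cosh √u`. -/
theorem cosh_le_of_sq_le {p q u w z : ℝ} (hp : 0 ≤ p) (hq : 0 ≤ q) (hpq : p + q = 1)
    (hz : z ^ 2 ≤ p * u ^ 2 + q * w ^ 2) :
    Real.cosh z ≤ p * Real.cosh u + q * Real.cosh w := by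
  have hu := (Real.hasSum_cosh u).mul_left p
  have hw := (Real.hasSum_cosh w).mul_left q
  -- The Taylor series in z² are compared termwise: each t ↦ t^k is monotone and convex on [0, ∞).
  refine hasSum_le (fun k => ?_) (Real.hasSum_cosh z) (hu.add hw)
  have h : (z ^ 2) ^ k ≤ p * (u ^ 2) ^ k + q * (w ^ 2) ^ k := by
    refine (pow_le_pow_left₀ (sq_nonneg z) hz k).trans ?_
    have := (convexOn_pow k).2 (sq_nonneg u) (sq_nonneg w) hp hq hpq
    simpa using this
  simp only [pow_mul]
  rw [← mul_div_assoc, ← mul_div_assoc, ← add_div]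
  gcongr

/-- The one-step inequality behind Pinelis' bound in a Hilbert space. -/
theorem exists_cosh_norm_add_le {E : Type*} [NormedAddCommGroup E] [InnerProductSpace ℝ E]
    (l b : ℝ) (v : E) :
    ∃ C : ℝ, ∀ y : E, ‖y‖ ≤ b →
      Real.cosh (l * ‖v + y‖) ≤ Real.cosh (l * ‖v‖) * Real.cosh (l * b) + C * inner ℝ v y := by
  -- `C` must not depend on `y`, so that its term integrates to zero for a centred law.
  refine ⟨Real.sinh (l * ‖v‖) * Real.sinh (l * b) / (‖v‖ * b), fun y hy => ?_⟩
  have hb : 0 ≤ b := (norm_nonneg y).trans hy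
  rcases eq_or_ne v 0 with rfl | hv
  · simp only [zero_add, norm_zero, mul_zero, Real.cosh_zero, one_mul, inner_zero_left, add_zero]
    rw [Real.cosh_le_cosh, abs_mul, abs_mul, abs_norm, abs_of_nonneg hb]
    gcongr
  rcases hb.eq_or_lt with rfl | hb
  · have : y = 0 := norm_le_zero_iff.1 hy
    subst this; simp
  have hv' : 0 < ‖v‖ := norm_pos_iff.2 hv
  set s : ℝ := inner ℝ v y / (‖v‖ * b) with hs
  have hs1 : |s| ≤ 1 := by
    rw [hs, abs_div, abs_of_pos (by positivity : 0 < ‖v‖ * b), div_le_one (by positivity)]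
    exact (abs_real_inner_le_norm v y).trans (by gcongr)
  obtain ⟨hs2, hs3⟩ := abs_le.1 hs1
  have hsv : inner ℝ v y = s * (‖v‖ * b) := by rw [hs]; field_simp
  -- ‖v + y‖² ≤ ‖v‖² + b² + 2s‖v‖b, which is the average of (‖v‖ ± b)² with weights (1 ± s)/2.
  have key := cosh_le_of_sq_le (p := (1 + s) / 2) (q := (1 - s) / 2) (u := l * ‖v‖ + l * b)
    (w := l * ‖v‖ - l * b) (z := l * ‖v + y‖) (by linarith) (by linarith) (by ring) (by
      rw [mul_pow, norm_add_sq_real, hsv]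
      have : ‖y‖ ^ 2 ≤ b ^ 2 := by gcongr
      nlinarith [mul_le_mul_of_nonneg_left this (sq_nonneg l)])
  rw [Real.cosh_add, Real.cosh_sub] at key
  refine key.trans (le_of_eq ?_)
  rw [hsv]
  field_simp
  ring

/-! ### Hilbert–Schmidt operators -/

section HilbertSchmidt

variable {ι ι' : Type*} {H H' : Type*} [NormedAddCommGroup H] [InnerProductSpace ℝ H]
  [NormedAddCommGroup H'] [InnerProductSpace ℝ H']

omit [InnerProductSpace ℝ H] in
theorem enorm_sq_eq_ofReal (x : H) : ‖x‖ₑ ^ 2 = ENNReal.ofReal (‖x‖ ^ 2) := by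
  rw [← ofReal_norm, ENNReal.ofReal_pow (norm_nonneg x)]

theorem hasSum_inner_sq (b : HilbertBasis ι ℝ H) (x : H) :
    HasSum (fun i => inner ℝ (b i) x ^ 2) (‖x‖ ^ 2) := by
  have h := b.hasSum_inner_mul_inner x x
  rw [real_inner_self_eq_norm_sq] at h
  refine h.congr_fun fun i => ?_
  rw [real_inner_comm, sq]

theorem tsum_enorm_inner_sq (b : HilbertBasis ι ℝ H) (x : H) :
    ∑' i, ‖inner ℝ (b i) x‖ₑ ^ 2 = ‖x‖ₑ ^ 2 := by
  rw [enorm_sq_eq_ofReal, ← (hasSum_inner_sq b x).tsum_eq,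
    ENNReal.ofReal_tsum_of_nonneg (fun _ => sq_nonneg _) (hasSum_inner_sq b x).summable]
  simp [enorm_sq_eq_ofReal]

/-- The square of the Hilbert–Schmidt norm of an operator, computed in a Hilbert basis. -/
noncomputable def hsSq (b : HilbertBasis ι ℝ H) (T : H →L[ℝ] H') : ℝ≥0∞ :=
  ∑' i, ‖T (b i)‖ₑ ^ 2

variable [CompleteSpace H] [CompleteSpace H']

/-- Parseval turns both sides into the same double series of squared matrix entries; Tonelli swaps
the order. Basis independence follows. -/
theorem hsSq_adjoint (b : HilbertBasis ι ℝ H) (b' : HilbertBasis ι' ℝ H') (T : H →L[ℝ] H') :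
    hsSq b' T.adjoint = hsSq b T := by
  unfold hsSq
  calc ∑' j, ‖T.adjoint (b' j)‖ₑ ^ 2
      = ∑' j, ∑' i, ‖inner ℝ (b i) (T.adjoint (b' j))‖ₑ ^ 2 := by
        simp_rw [tsum_enorm_inner_sq b]
    _ = ∑' i, ∑' j, ‖inner ℝ (b' j) (T (b i))‖ₑ ^ 2 := by
        rw [ENNReal.tsum_comm]
        simp_rw [ContinuousLinearMap.adjoint_inner_right, real_inner_comm]
    _ = ∑' i, ‖T (b i)‖ₑ ^ 2 := by simp_rw [tsum_enorm_inner_sq b']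

theorem hsSq_eq {ι₂ : Type*} (b : HilbertBasis ι ℝ H) (b₂ : HilbertBasis ι₂ ℝ H)
    (T : H →L[ℝ] H') : hsSq b T = hsSq b₂ T := by
  obtain ⟨w, b', -⟩ := exists_hilbertBasis ℝ H'
  rw [← hsSq_adjoint b b', hsSq_adjoint b₂ b']

theorem enorm_apply_sq_le_hsSq (b : HilbertBasis ι ℝ H) (T : H →L[ℝ] H') (x : H) :
    ‖T x‖ₑ ^ 2 ≤ hsSq b T * ‖x‖ₑ ^ 2 := by
  obtain ⟨w, b', -⟩ := exists_hilbertBasis ℝ H'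
  rw [← hsSq_adjoint b b', ← tsum_enorm_inner_sq b' (T x), hsSq, ← ENNReal.tsum_mul_right]
  refine ENNReal.tsum_le_tsum fun j => ?_
  rw [← ContinuousLinearMap.adjoint_inner_left, ← mul_pow]
  gcongr
  rw [mul_comm, ← ofReal_norm, ← ofReal_norm, ← ofReal_norm,
    ← ENNReal.ofReal_mul (norm_nonneg _), mul_comm]
  exact ENNReal.ofReal_le_ofReal (norm_inner_le_norm _ _)

theorem norm_le_sqrt_hsSq (b : HilbertBasis ι ℝ H) (T : H →L[ℝ] H') (hT : hsSq b T ≠ ∞) :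
    ‖T‖ ≤ √(hsSq b T).toReal := by
  refine T.opNorm_le_bound (Real.sqrt_nonneg _) fun x => ?_
  rw [← Real.sqrt_sq (norm_nonneg x), ← Real.sqrt_mul ENNReal.toReal_nonneg]
  refine Real.le_sqrt_of_sq_le ?_
  have h := ENNReal.toReal_mono (by finiteness) (enorm_apply_sq_le_hsSq b T x)
  simpa [ENNReal.toReal_mul] using h

omit [CompleteSpace H] [CompleteSpace H'] in
theorem isCompactOperator_sum_rankOne (s : Finset ι) (u : ι → H) (v : ι → H') :
    IsCompactOperator (∑ i ∈ s, (innerSL ℝ (u i)).smulRight (v i) : H →L[ℝ] H') := by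
  classical
  induction s using Finset.induction_on with
  | empty => simpa using isCompactOperator_zero
  | insert i s hi ih =>
    rw [Finset.sum_insert hi]
    refine IsCompactOperator.add ?_ ih
    have h : IsCompactOperator (innerSL ℝ (u i)) :=
      (isCompactOperator_id (E := ℝ)).comp_clm (innerSL ℝ (u i))
    exact h.clm_comp (ContinuousLinearMap.toSpanSingleton ℝ (v i))

/-- Truncations to finitely many basis vectors have finite rank, and the squared Hilbert–Schmidt
norm of the remainder is the tail of a convergent series. -/
theorem isCompactOperator_of_hsSq_ne_top (b : HilbertBasis ι ℝ H) (T : H →L[ℝ] H')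
    (hT : hsSq b T ≠ ∞) : IsCompactOperator T := by
  classical
  set F : Finset ι → H →L[ℝ] H' := fun s => ∑ i ∈ s, (innerSL ℝ (b i)).smulRight (T (b i))
  refine isCompactOperator_of_tendsto (F := F) (l := atTop) ?_
    (Eventually.of_forall fun s => isCompactOperator_sum_rankOne s _ _)
  have hF : ∀ s i, (T - F s) (b i) = if i ∈ s then 0 else T (b i) := by
    intro s i
    simp [F, orthonormal_iff_ite.1 b.orthonormal, ite_smul]
    split_ifs <;> simp
  have hs : ∀ s, hsSq b (T - F s) = ∑' i : {i // i ∉ s}, ‖T (b i)‖ₑ ^ 2 := by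
    intro s
    rw [hsSq, show (∑' i : {i // i ∉ s}, ‖T (b i)‖ₑ ^ 2)
      = ∑' i : ({i | i ∉ s} : Set ι), ‖T (b i)‖ₑ ^ 2 from rfl,
      tsum_subtype {i | i ∉ s} fun i => ‖T (b i)‖ₑ ^ 2]
    refine tsum_congr fun i => ?_
    rw [hF]
    by_cases h : i ∈ s <;> simp [h]
  have h0 : Tendsto (fun s => hsSq b (T - F s)) atTop (𝓝 0) := by
    simp_rw [hs]
    exact ENNReal.tendsto_tsum_compl_atTop_zero hT
  have hfin : ∀ s, hsSq b (T - F s) ≠ ∞ := fun s => by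
    refine ne_top_of_le_ne_top hT (ENNReal.tsum_le_tsum fun i => ?_)
    rw [hF]; split_ifs <;> simp
  rw [tendsto_iff_norm_sub_tendsto_zero]
  have h1 : Tendsto (fun s => √(hsSq b (T - F s)).toReal) atTop (𝓝 0) := by
    have := (ENNReal.tendsto_toReal ENNReal.zero_ne_top).comp h0
    have h2 := (Real.continuous_sqrt.tendsto _).comp this
    rwa [ENNReal.toReal_zero, Real.sqrt_zero] at h2
  refine squeeze_zero (fun _ => norm_nonneg _) (fun s => ?_) h1
  rw [norm_sub_rev]
  exact norm_le_sqrt_hsSq b _ (hfin s)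

omit [CompleteSpace H] [CompleteSpace H'] in
theorem hasSum_norm_sq_of_hsSq_ne_top (b : HilbertBasis ι ℝ H) (T : H →L[ℝ] H')
    (hT : hsSq b T ≠ ∞) : HasSum (fun i => ‖T (b i)‖ ^ 2) (hsSq b T).toReal := by
  have h := ENNReal.hasSum_toReal hT
  rw [← ENNReal.tsum_toReal_eq fun i => ENNReal.ne_top_of_tsum_ne_top hT i] at h
  refine h.congr_fun fun i => ?_
  simp

end HilbertSchmidt

/-! ### Spectral theorem for compact self-adjoint operators -/

section Diagonalization

universe u

variable {H : Type u} [NormedAddCommGroup H] [InnerProductSpace ℝ H]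

/-- Spectral theorem: a compact self-adjoint operator has a Hilbert basis of eigenvectors. -/
theorem exists_eigenbasis [CompleteSpace H] (T : H →L[ℝ] H) (hT : IsCompactOperator T)
    (hs : (T : H →ₗ[ℝ] H).IsSymmetric) :
    ∃ (ι : Type u) (b : HilbertBasis ι ℝ H) (a : ι → ℝ), ∀ i, T (b i) = a i • b i := by
  let E : ℝ → Submodule ℝ H := fun μ => Module.End.eigenspace (T : H →ₗ[ℝ] H) μ
  have hc : ∀ μ, CompleteSpace (E μ) := fun μ => by
    have : IsClosed (E μ : Set H) := by
      have : (E μ : Set H) = {x | T x = μ • x} := by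
        ext x; simp [E]
      rw [this]
      exact isClosed_eq T.continuous (continuous_const_smul μ)
    exact this.completeSpace_coe
  -- `μ` runs over all reals; a trivial eigenspace contributes an empty index set. The glued family
  -- is total because the eigenspaces have no common orthogonal vector.
  choose w c hw using fun μ => exists_hilbertBasis ℝ (E μ)
  have ho := hs.orthogonalFamily_eigenspaces
  have hon : Orthonormal ℝ fun p : Σ μ, w μ => ((c p.1 p.2 : E p.1) : H) :=
    ho.orthonormal_sigma_orthonormal fun μ => (c μ).orthonormal
  refine ⟨Σ μ, w μ, HilbertBasis.mkOfOrthogonalEqBot hon ?_, fun p => p.1, fun p => ?_⟩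
  · rw [eq_bot_iff, ← T.orthogonalComplement_iSup_eigenspaces_eq_bot hT hs]
    intro x hx
    suffices hle : (⨆ μ, Module.End.eigenspace (T : H →ₗ[ℝ] H) μ) ≤ (Submodule.span ℝ {x})ᗮ from
      (Submodule.mem_orthogonal _ _).2 fun u hu =>
        Submodule.mem_orthogonal_singleton_iff_inner_left.1 (hle hu)
    refine iSup_le fun μ y hy => Submodule.mem_orthogonal_singleton_iff_inner_right.2 ?_
    have h := (c μ).hasSum_repr ⟨y, hy⟩
    have h' := (h.mapL (E μ).subtypeL).mapL (innerSL ℝ x)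
    refine h'.unique ?_
    convert hasSum_zero with i
    have : inner ℝ ((c μ i : E μ) : H) x = 0 :=
      (Submodule.mem_orthogonal _ _).1 hx _ (Submodule.subset_span ⟨⟨μ, i⟩, rfl⟩)
    rw [real_inner_comm] at this
    simp [this]
  · rw [HilbertBasis.coe_mkOfOrthogonalEqBot]
    exact Module.End.mem_eigenspace_iff.1 (c p.1 p.2).2

end Diagonalization

/-! ### Common nonzero spectrum of Z*Z and ZZ* -/

section Transfer

universe v

variable {ι : Type*} {H : Type*} {H' : Type v} [NormedAddCommGroup H] [InnerProductSpace ℝ H]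
  [NormedAddCommGroup H'] [InnerProductSpace ℝ H'] [CompleteSpace H] [CompleteSpace H']

theorem eigenvalue_adjoint_comp_self (Z : H →L[ℝ] H') (b : HilbertBasis ι ℝ H) (a : ι → ℝ)
    (h : ∀ i, Z.adjoint (Z (b i)) = a i • b i) (i : ι) : a i = ‖Z (b i)‖ ^ 2 := by
  rw [← real_inner_self_eq_norm_sq, ← ContinuousLinearMap.adjoint_inner_left, h,
    real_inner_smul_left, real_inner_self_eq_norm_sq, b.orthonormal.1 i]
  simp

/-- `Z⋆Z` and `ZZ⋆` have the same nonzero eigenvalues, with multiplicity. -/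
theorem exists_eigenbasis_comp_adjoint (Z : H →L[ℝ] H') (b : HilbertBasis ι ℝ H) (a : ι → ℝ)
    (h : ∀ i, Z.adjoint (Z (b i)) = a i • b i) :
    ∃ (ι' : Type v) (b' : HilbertBasis ι' ℝ H') (a' : ι' → ℝ),
      (∀ j, Z (Z.adjoint (b' j)) = a' j • b' j) ∧
      ∀ g : ℝ → ℝ, g 0 = 0 → ∀ S, HasSum (fun i => g (a i)) S ↔ HasSum (fun j => g (a' j)) S := by
  have ha := eigenvalue_adjoint_comp_self Z b a h
  have ha0 : ∀ i, 0 ≤ a i := fun i => by rw [ha]; positivity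
  have hin : ∀ i j, inner ℝ (Z (b i)) (Z (b j)) = a j * inner ℝ (b i) (b j) := fun i j => by
    rw [← ContinuousLinearMap.adjoint_inner_right, h, real_inner_smul_right]
  -- The left singular vectors Z bᵢ / ‖Z bᵢ‖. They are extended to a basis whose other members are
  -- orthogonal to the range of Z, hence killed by Z*.
  let u : {i // a i ≠ 0} → H' := fun i => (√(a i))⁻¹ • Z (b i)
  have hsq : ∀ i : {i // a i ≠ 0}, √(a i) ≠ 0 := fun i =>
    (Real.sqrt_pos.2 ((ha0 i).lt_of_ne' i.2)).ne'
  have hZu : ∀ i : {i // a i ≠ 0}, Z (Z.adjoint (u i)) = a i • u i := fun i => by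
    simp only [u, map_smul, h]
    rw [smul_comm]
  have hu : Orthonormal ℝ u := by
    classical
    rw [orthonormal_iff_ite]
    intro i j
    simp only [u, real_inner_smul_left, real_inner_smul_right, hin,
      orthonormal_iff_ite.1 b.orthonormal, Subtype.coe_inj]
    split_ifs with hij
    · subst hij
      have := Real.mul_self_sqrt (ha0 i)
      have h1 := hsq i
      field_simp
      nlinarith
    · simp
  obtain ⟨w, b', hw, hb'⟩ := hu.toSubtypeRange.exists_hilbertBasis_extension
  have hZu' : ∀ i : {i // a i ≠ 0}, ‖Z.adjoint (u i)‖ ^ 2 = a i := fun i => by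
    rw [← real_inner_self_eq_norm_sq, ContinuousLinearMap.adjoint_inner_left, hZu,
      real_inner_smul_right, real_inner_self_eq_norm_sq, hu.1]
    simp
  have hzero : ∀ j : w, (j : H') ∉ Set.range u → Z.adjoint (j : H') = 0 := by
    intro j hj
    have : ∀ i, inner ℝ (b i) (Z.adjoint (j : H')) = 0 := by
      intro i
      rw [ContinuousLinearMap.adjoint_inner_right]
      by_cases hi : a i = 0
      · have : Z (b i) = 0 := by
          rw [ha] at hi; simpa using hi
        rw [this, inner_zero_left]
      · have hne : (⟨u ⟨i, hi⟩, hw ⟨_, rfl⟩⟩ : w) ≠ j := fun hc => hj ⟨⟨i, hi⟩, by rw [← hc]⟩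
        have h0 := b'.orthonormal.2 hne
        rw [hb'] at h0
        have : Z (b i) = √(a i) • u ⟨i, hi⟩ := by
          simp only [u, smul_smul]
          rw [mul_inv_cancel₀ (hsq ⟨i, hi⟩), one_smul]
        rw [this, real_inner_smul_left]
        simpa using Or.inr h0
    have h2 := hasSum_inner_sq b (Z.adjoint (j : H'))
    have h3 : ‖Z.adjoint (j : H')‖ ^ 2 = 0 := h2.unique (by simp [this, hasSum_zero])
    simpa using h3
  refine ⟨w, b', fun j => ‖Z.adjoint (j : H')‖ ^ 2, fun j => ?_, fun g hg S => ?_⟩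
  · rw [hb']
    by_cases hj : (j : H') ∈ Set.range u
    · obtain ⟨i, hi⟩ := hj
      beta_reduce
      rw [← hi, hZu, hZu']
    · simp [hzero j hj]
  · let e : {i // a i ≠ 0} → w := fun i => ⟨u i, hw ⟨i, rfl⟩⟩
    have he : Function.Injective e := fun i j hij =>
      hu.linearIndependent.injective (congrArg Subtype.val hij)
    rw [← Function.Injective.hasSum_iff (g := (Subtype.val : {i // a i ≠ 0} → ι))
      Subtype.val_injective, ← Function.Injective.hasSum_iff he]
    · simp only [e, Function.comp_def, hZu']
    · intro j hj
      have : (j : H') ∉ Set.range u := by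
        rintro ⟨i, hi⟩
        exact hj ⟨i, Subtype.ext hi⟩
      simp [hzero j this, hg]
    · intro i hi
      have : a i = 0 := by
        by_contra hne
        exact hi ⟨⟨i, hne⟩, rfl⟩
      rw [this, hg]

end Transfer

/-! ### Trace inequality for f -/

section Klein

theorem summable_mul_and_tsum_le {ι : Type*} {p q : ι → ℝ} {P Q : ℝ}
    (hp : ∀ i, 0 ≤ p i) (hq : ∀ i, 0 ≤ q i)
    (hP : HasSum (fun i => p i ^ 2) P) (hQ : HasSum (fun i => q i ^ 2) Q) :
    Summable (fun i => p i * q i) ∧ ∑' i, p i * q i ≤ √P * √Q := by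
  have h : ∀ s : Finset ι, ∑ i ∈ s, p i * q i ≤ √P * √Q := fun s => by
    refine (Real.sum_mul_le_sqrt_mul_sqrt s p q).trans ?_
    gcongr
    · exact sum_le_hasSum s (fun _ _ => sq_nonneg _) hP
    · exact sum_le_hasSum s (fun _ _ => sq_nonneg _) hQ
  have h0 : ∀ i, 0 ≤ p i * q i := fun i => mul_nonneg (hp i) (hq i)
  exact ⟨summable_of_sum_le h0 h, Real.tsum_le_of_sum_le h0 h⟩

variable {ι ι' : Type*} {H H' : Type*} [NormedAddCommGroup H] [InnerProductSpace ℝ H]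
  [NormedAddCommGroup H'] [InnerProductSpace ℝ H'] [CompleteSpace H] [CompleteSpace H']

omit [CompleteSpace H] in
theorem hasSum_mul_inner_sq (T : H →L[ℝ] H) (b : HilbertBasis ι ℝ H) (a : ι → ℝ)
    (h : ∀ i, T (b i) = a i • b i) (x y : H) :
    HasSum (fun i => a i * (inner ℝ (b i) x * inner ℝ (b i) y)) (inner ℝ (T x) y) := by
  have h1 := ((b.hasSum_repr x).mapL T).mapL (innerSL ℝ y)
  simp only [innerSL_apply_apply] at h1
  rw [real_inner_comm]
  refine h1.congr_fun fun i => ?_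
  rw [map_smul, h, real_inner_smul_right, real_inner_smul_right, b.repr_apply_apply,
    real_inner_comm y]
  ring

/-- A Klein-type trace inequality for the function `f`, with Hilbert–Schmidt control. -/
theorem hasSum_scalarF_le (G G' : H →L[ℝ] H') (v : HilbertBasis ι ℝ H) (w : HilbertBasis ι' ℝ H)
    (a : ι → ℝ) (b : ι' → ℝ) (ha : ∀ i, G.adjoint (G (v i)) = a i • v i)
    (hb : ∀ j, G'.adjoint (G' (w j)) = b j • w j) {c A d : ℝ} (hc : 0 ≤ c) (hA : 0 ≤ A)
    (hd : 0 ≤ d) (hG : hsSq w G ≤ ENNReal.ofReal (A ^ 2)) (hG' : hsSq w G' ≤ ENNReal.ofReal (A ^ 2))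
    (hD : hsSq w (G - G') ≤ ENNReal.ofReal (d ^ 2)) {S S' : ℝ}
    (hS : HasSum (fun i => scalarF (c * a i)) S) (hS' : HasSum (fun j => scalarF (c * b j)) S') :
    S ≤ S' + c / 4 * (2 * A * d) := by
  have key : ∀ (T : H →L[ℝ] H') (t : ℝ), 0 ≤ t → hsSq w T ≤ ENNReal.ofReal (t ^ 2) →
      ∃ P, HasSum (fun j => ‖T (w j)‖ ^ 2) P ∧ √P ≤ t := fun T t ht h => by
    refine ⟨_, hasSum_norm_sq_of_hsSq_ne_top w T (ne_top_of_le_ne_top (by finiteness) h), ?_⟩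
    refine Real.sqrt_le_iff.2 ⟨ht, ?_⟩
    exact ENNReal.toReal_le_of_le_ofReal (sq_nonneg t) h
  obtain ⟨P, hP, hP'⟩ := key G A hA hG
  obtain ⟨P', hPs, hPs'⟩ := key G' A hA hG'
  obtain ⟨Q, hQ, hQ'⟩ := key (G - G') d hd hD
  obtain ⟨s1, t1⟩ := summable_mul_and_tsum_le (fun j => norm_nonneg _) (fun j => norm_nonneg _) hP hQ
  obtain ⟨s2, t2⟩ := summable_mul_and_tsum_le (fun j => norm_nonneg _) (fun j => norm_nonneg _) hPs hQ
  have hbn := eigenvalue_adjoint_comp_self G' w b hb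
  have han := eigenvalue_adjoint_comp_self G v a ha
  have ha0 : ∀ i, 0 ≤ c * a i := fun i => by rw [han]; positivity
  have hb0 : ∀ i, 0 ≤ c * b i := fun i => by rw [hbn]; positivity
  set r : ι' → ℝ := fun j => scalarF (c * b j) +
    c / 4 * (‖G (w j)‖ * ‖(G - G') (w j)‖ + ‖G' (w j)‖ * ‖(G - G') (w j)‖) with hr
  have hrsum : HasSum r (S' + c / 4 * (∑' j, ‖G (w j)‖ * ‖(G - G') (w j)‖
      + ∑' j, ‖G' (w j)‖ * ‖(G - G') (w j)‖)) :=
    hS'.add ((s1.hasSum.add s2.hasSum).mul_left _)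
  have hr0 : ∀ j, 0 ≤ r j := fun j => by
    have := scalarF_nonneg (hb0 j)
    simp only [hr]
    positivity
  -- The squares of ⟨w j, v i⟩ over i are probability weights with mean of a i equal to ‖G (w j)‖²,
  -- while b j = ‖G' (w j)‖². Averaging the tangent bound at c·b j gives the estimate.
  have step : ∀ j, ∑' i, ENNReal.ofReal (scalarF (c * a i)) * ‖inner ℝ (w j) (v i)‖ₑ ^ 2
      ≤ ENNReal.ofReal (r j) := by
    intro j
    obtain ⟨m, hm0, hm, hf⟩ := exists_slope_scalarF (hb0 j)
    have h1 := hasSum_inner_sq v (w j)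
    have h2 := hasSum_mul_inner_sq (G.adjoint ∘L G) v a ha (w j) (w j)
    rw [w.orthonormal.1 j] at h1
    rw [ContinuousLinearMap.comp_apply, ContinuousLinearMap.adjoint_inner_left,
      real_inner_self_eq_norm_sq] at h2
    have h3 := (h1.mul_left (scalarF (c * b j) - m * (c * b j))).add (h2.mul_left (m * c))
    have hle : ∀ i, scalarF (c * a i) * inner ℝ (v i) (w j) ^ 2 ≤
        (scalarF (c * b j) - m * (c * b j)) * inner ℝ (v i) (w j) ^ 2 +
          m * c * (a i * (inner ℝ (v i) (w j) * inner ℝ (v i) (w j))) := fun i => by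
      have := mul_le_mul_of_nonneg_right (hf _ (ha0 i)) (sq_nonneg (inner ℝ (v i) (w j)))
      linarith
    have h0 : ∀ i, 0 ≤ scalarF (c * a i) * inner ℝ (v i) (w j) ^ 2 := fun i =>
      mul_nonneg (scalarF_nonneg (ha0 i)) (sq_nonneg _)
    calc ∑' i, ENNReal.ofReal (scalarF (c * a i)) * ‖inner ℝ (w j) (v i)‖ₑ ^ 2
        = ∑' i, ENNReal.ofReal (scalarF (c * a i) * inner ℝ (v i) (w j) ^ 2) := by
          refine tsum_congr fun i => ?_
          rw [ENNReal.ofReal_mul (scalarF_nonneg (ha0 i)), enorm_sq_eq_ofReal, real_inner_comm,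
            Real.norm_eq_abs, sq_abs]
      _ ≤ ∑' i, ENNReal.ofReal ((scalarF (c * b j) - m * (c * b j)) * inner ℝ (v i) (w j) ^ 2 +
          m * c * (a i * (inner ℝ (v i) (w j) * inner ℝ (v i) (w j)))) :=
          ENNReal.tsum_le_tsum fun i => ENNReal.ofReal_le_ofReal (hle i)
      _ = ENNReal.ofReal ((scalarF (c * b j) - m * (c * b j)) * 1 ^ 2 + m * c * ‖G (w j)‖ ^ 2) := by
          rw [← ENNReal.ofReal_tsum_of_nonneg (fun i => (h0 i).trans (hle i)) h3.summable,
            h3.tsum_eq]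
      _ ≤ ENNReal.ofReal (r j) := by
          refine ENNReal.ofReal_le_ofReal ?_
          rw [hbn j]
          have h4 : |‖G (w j)‖ - ‖G' (w j)‖| ≤ ‖(G - G') (w j)‖ := by
            simpa using abs_norm_sub_norm_le (G (w j)) (G' (w j))
          have h5 : ‖G (w j)‖ ^ 2 - ‖G' (w j)‖ ^ 2
              ≤ (‖G (w j)‖ + ‖G' (w j)‖) * ‖(G - G') (w j)‖ := by
            rw [sq_sub_sq]
            gcongr
            exact (le_abs_self _).trans h4
          have h6 : m * c * (‖G (w j)‖ ^ 2 - ‖G' (w j)‖ ^ 2)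
              ≤ c / 4 * ((‖G (w j)‖ + ‖G' (w j)‖) * ‖(G - G') (w j)‖) := by
            calc _ ≤ m * c * ((‖G (w j)‖ + ‖G' (w j)‖) * ‖(G - G') (w j)‖) := by gcongr
              _ ≤ 1 / 4 * c * ((‖G (w j)‖ + ‖G' (w j)‖) * ‖(G - G') (w j)‖) := by gcongr
              _ = _ := by ring
          simp only [hr, hbn j]
          linarith
  -- Summing `step` over j: Parseval for each v i and Tonelli recover S on the left.
  have total : ENNReal.ofReal S ≤ ENNReal.ofReal (S' + c / 4 * (∑' j, ‖G (w j)‖ * ‖(G - G') (w j)‖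
      + ∑' j, ‖G' (w j)‖ * ‖(G - G') (w j)‖)) := by
    calc ENNReal.ofReal S = ∑' i, ENNReal.ofReal (scalarF (c * a i)) := by
          rw [← hS.tsum_eq, ENNReal.ofReal_tsum_of_nonneg (fun i => scalarF_nonneg (ha0 i))
            hS.summable]
      _ = ∑' i, ∑' j, ENNReal.ofReal (scalarF (c * a i)) * ‖inner ℝ (w j) (v i)‖ₑ ^ 2 := by
          refine tsum_congr fun i => ?_
          rw [ENNReal.tsum_mul_left, tsum_enorm_inner_sq w, enorm_sq_eq_ofReal, v.orthonormal.1 i]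
          simp
      _ = ∑' j, ∑' i, ENNReal.ofReal (scalarF (c * a i)) * ‖inner ℝ (w j) (v i)‖ₑ ^ 2 :=
          ENNReal.tsum_comm
      _ ≤ ∑' j, ENNReal.ofReal (r j) := ENNReal.tsum_le_tsum step
      _ = _ := by rw [← ENNReal.ofReal_tsum_of_nonneg hr0 hrsum.summable, hrsum.tsum_eq]
  have h7 := (ENNReal.ofReal_le_ofReal_iff (hrsum.nonneg hr0)).1 total
  refine h7.trans ?_
  have h8 : √P * √Q ≤ A * d := by gcongr
  have h9 : √P' * √Q ≤ A * d := by gcongr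
  have : ∑' j, ‖G (w j)‖ * ‖(G - G') (w j)‖ + ∑' j, ‖G' (w j)‖ * ‖(G - G') (w j)‖ ≤ 2 * A * d := by
    linarith
  gcongr

end Klein

/-! ### Square root, trace and determinant in an eigenbasis -/

section Operators

variable {ι : Type*} {H : Type*} [NormedAddCommGroup H] [InnerProductSpace ℝ H] [CompleteSpace H]

omit [CompleteSpace H] in
theorem clm_ext_hilbertBasis (b : HilbertBasis ι ℝ H) {T T' : H →L[ℝ] H}
    (h : ∀ i, T (b i) = T' (b i)) : T = T' :=
  ContinuousLinearMap.ext_on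
    ((Submodule.dense_iff_topologicalClosure_eq_top).2 b.dense_span) fun _ ⟨i, hi⟩ => hi ▸ h i

theorem isPositive_of_eigenbasis (T : H →L[ℝ] H) (b : HilbertBasis ι ℝ H) (a : ι → ℝ)
    (h : ∀ i, T (b i) = a i • b i) (ha : ∀ i, 0 ≤ a i) : T.IsPositive := by
  refine (ContinuousLinearMap.isPositive_iff' T).2 ⟨?_, fun x => ?_⟩
  · rw [ContinuousLinearMap.isSelfAdjoint_iff_isSymmetric]
    intro x y
    refine (hasSum_mul_inner_sq T b a h x y).unique ?_
    have := hasSum_mul_inner_sq T b a h y x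
    rw [real_inner_comm] at this
    refine this.congr_fun fun i => ?_
    ring
  · exact (hasSum_mul_inner_sq T b a h x x).nonneg fun i => mul_nonneg (ha i) (mul_self_nonneg _)

omit [CompleteSpace H] in
theorem eigenvalue_nonneg_of_isPositive {T : H →L[ℝ] H} (hT : T.IsPositive)
    {b : HilbertBasis ι ℝ H} {a : ι → ℝ} (h : ∀ i, T (b i) = a i • b i) (i : ι) : 0 ≤ a i := by
  have := hT.inner_nonneg_left (b i)
  rw [h, real_inner_smul_left, real_inner_self_eq_norm_sq, b.orthonormal.1 i] at this
  simpa using this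

omit [CompleteSpace H] in
theorem abs_eigenvalue_le {T : H →L[ℝ] H} {b : HilbertBasis ι ℝ H} {a : ι → ℝ}
    (h : ∀ i, T (b i) = a i • b i) (i : ι) : |a i| ≤ ‖T‖ := by
  have := T.le_opNorm (b i)
  rw [h, norm_smul, b.orthonormal.1 i] at this
  simpa using this

omit [CompleteSpace H] in
/-- Diagonal operators in a Hilbert basis. -/
theorem exists_diagonal (b : HilbertBasis ι ℝ H) (m : ι → ℝ) (M : ℝ) (hM : 0 ≤ M)
    (hm : ∀ i, |m i| ≤ M) : ∃ R : H →L[ℝ] H, ∀ i, R (b i) = m i • b i := by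
  classical
  let D := lp.mapCLM (E := fun _ : ι => ℝ) (F := fun _ : ι => ℝ) 2
    (fun i => m i • ContinuousLinearMap.id ℝ ℝ) hM fun i => by
      refine (norm_smul_le _ _).trans ?_
      calc ‖m i‖ * ‖ContinuousLinearMap.id ℝ ℝ‖ ≤ M * 1 := by
            gcongr
            · exact hm i
            · exact ContinuousLinearMap.norm_id_le
        _ = M := mul_one M
  refine ⟨(b.repr.symm.toContinuousLinearEquiv : _ →L[ℝ] H) ∘L D ∘L
    (b.repr.toContinuousLinearEquiv : H →L[ℝ] _), fun i => ?_⟩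
  have : D (lp.single 2 i (1 : ℝ)) = m i • lp.single 2 i (1 : ℝ) := by
    ext j
    by_cases hj : j = i
    · subst hj; simp [D]
    · simp [D, hj]
  simp only [ContinuousLinearMap.comp_apply, ContinuousLinearEquiv.coe_coe,
    LinearIsometryEquiv.coe_toContinuousLinearEquiv, b.repr_self, this, map_smul,
    b.repr_symm_single]

omit [CompleteSpace H] in
theorem posSqrt_spec {A : H →L[ℝ] H} (h : ∃ R : H →L[ℝ] H, R.IsPositive ∧ R * R = A) :
    (posSqrt A).IsPositive ∧ posSqrt A * posSqrt A = A := by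
  rw [posSqrt, dif_pos h]
  exact h.choose_spec

theorem exists_sqrt_of_eigenbasis (A : H →L[ℝ] H) (b : HilbertBasis ι ℝ H) (a : ι → ℝ)
    (h : ∀ i, A (b i) = a i • b i) (ha : ∀ i, 0 ≤ a i) :
    ∃ R : H →L[ℝ] H, (∀ i, R (b i) = √(a i) • b i) ∧ R.IsPositive ∧ R * R = A := by
  obtain ⟨R, hR⟩ := exists_diagonal b (fun i => √(a i)) (√‖A‖) (Real.sqrt_nonneg _) fun i => by
    rw [abs_of_nonneg (Real.sqrt_nonneg _)]
    exact Real.sqrt_le_sqrt ((le_abs_self _).trans (abs_eigenvalue_le h i))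
  refine ⟨R, hR, isPositive_of_eigenbasis R b _ hR fun i => Real.sqrt_nonneg _,
    clm_ext_hilbertBasis b fun i => ?_⟩
  rw [show (R * R) (b i) = R (R (b i)) from rfl, hR, map_smul, hR, smul_smul, Real.mul_self_sqrt (ha i), h]

/-- `posSqrt` is an arbitrary choice, so this is a uniqueness statement. The defect y = R bᵢ − √aᵢ
bᵢ satisfies R y = −√aᵢ y, which positivity of R excludes unless y = 0; the case aᵢ = 0 uses
symmetry of R. -/
theorem posSqrt_apply_of_eigenbasis (A : H →L[ℝ] H) (b : HilbertBasis ι ℝ H) (a : ι → ℝ)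
    (h : ∀ i, A (b i) = a i • b i) (ha : ∀ i, 0 ≤ a i) (i : ι) :
    posSqrt A (b i) = √(a i) • b i := by
  obtain ⟨R₀, -, hR₀⟩ := exists_sqrt_of_eigenbasis A b a h ha
  obtain ⟨hp, hs⟩ := posSqrt_spec ⟨R₀, hR₀⟩
  set R := posSqrt A
  have hRR : R (R (b i)) = a i • b i := by
    rw [← h, ← hs]; rfl
  have hsa := Real.mul_self_sqrt (ha i)
  set y := R (b i) - √(a i) • b i with hy
  have h1 : R y = -(√(a i) • y) := by
    rw [hy, map_sub, map_smul, hRR, smul_sub, smul_smul, hsa]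
    abel
  have h2 := hp.inner_nonneg_left y
  rw [h1, inner_neg_left, real_inner_smul_left, real_inner_self_eq_norm_sq] at h2
  have h3 : ‖y‖ = 0 := by
    rcases (Real.sqrt_nonneg (a i)).eq_or_lt with h0 | h0
    · have hz : y = R (b i) := by rw [hy, ← h0, zero_smul, sub_zero]
      have : R y = 0 := by rw [h1, ← h0, zero_smul, neg_zero]
      rw [hz] at this ⊢
      have h4 : ‖R (b i)‖ ^ 2 = 0 := by
        rw [← real_inner_self_eq_norm_sq, hp.inner_left_eq_inner_right, this, inner_zero_right]
      simpa using h4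
    · have : ‖y‖ ^ 2 ≤ 0 := by nlinarith [sq_nonneg ‖y‖]
      nlinarith [norm_nonneg y]
  exact sub_eq_zero.1 (norm_eq_zero.1 h3)

theorem opM_apply_of_eigenbasis (ε : ℝ) (A B : H →L[ℝ] H) (b : HilbertBasis ι ℝ H) (a : ι → ℝ)
    (h : ∀ i, posSqrt A (B (posSqrt A (b i))) = a i • b i) (ha : ∀ i, 0 ≤ a i) (i : ι) :
    opM ε A B (b i) = (√(1 + 16 / ε ^ 2 * a i) - 1) • b i := by
  have := posSqrt_apply_of_eigenbasis (1 + (16 / ε ^ 2) • (posSqrt A * B * posSqrt A)) b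
    (fun i => 1 + 16 / ε ^ 2 * a i) (fun i => by
      simp [h, add_smul, smul_smul]) (fun i => by have := ha i; positivity) i
  rw [opM, add_apply, this, sub_smul]
  simp
  abel

/-- Frees `opTrace` from its chosen basis: ⟨T T* e, e⟩ = ‖T* e‖², and the Hilbert–Schmidt norm may
be computed in any basis on the other side. -/
theorem opTrace_comp_adjoint {H' : Type*} [NormedAddCommGroup H'] [InnerProductSpace ℝ H']
    [CompleteSpace H'] (T : H' →L[ℝ] H) (b : HilbertBasis ι ℝ H') (hT : hsSq b T ≠ ∞) :
    opTrace (T ∘L T.adjoint) = (hsSq b T).toReal := by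
  rw [← hsSq_adjoint b (exists_hilbertBasis ℝ H).choose_spec.choose] at hT ⊢
  rw [← (hasSum_norm_sq_of_hsSq_ne_top _ _ hT).tsum_eq, opTrace]
  refine tsum_congr fun k => ?_
  rw [ContinuousLinearMap.comp_apply, ← ContinuousLinearMap.adjoint_inner_right,
    real_inner_self_eq_norm_sq]

theorem opTrace_of_eigenbasis (T : H →L[ℝ] H) (b : HilbertBasis ι ℝ H) (a : ι → ℝ)
    (h : ∀ i, T (b i) = a i • b i) (ha : ∀ i, 0 ≤ a i) {S : ℝ} (hS : HasSum a S) :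
    opTrace T = S := by
  obtain ⟨R, hR, hp, hs⟩ := exists_sqrt_of_eigenbasis T b a h ha
  have hR2 : hsSq b R = ENNReal.ofReal S := by
    rw [hsSq, ← hS.tsum_eq, ENNReal.ofReal_tsum_of_nonneg ha hS.summable]
    refine tsum_congr fun i => ?_
    rw [hR, enorm_sq_eq_ofReal, norm_smul, b.orthonormal.1 i, mul_one, Real.norm_eq_abs, sq_abs,
      Real.sq_sqrt (ha i)]
  have : T = R ∘L R.adjoint := by
    rw [(ContinuousLinearMap.isSelfAdjoint_iff'.1 hp.isSelfAdjoint), ← hs]; rfl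
  rw [this, opTrace_comp_adjoint R b (by rw [hR2]; finiteness), hR2,
    ENNReal.toReal_ofReal (hS.nonneg ha)]

omit [CompleteSpace H] in
theorem finrank_eigenspace_of_eigenbasis (T : H →L[ℝ] H) (b : HilbertBasis ι ℝ H) (a : ι → ℝ)
    (h : ∀ i, T (b i) = a i • b i) (hT : (T : H →ₗ[ℝ] H).IsSymmetric) (μ : ℝ)
    (hf : (a ⁻¹' {μ}).Finite) :
    Module.finrank ℝ (Module.End.eigenspace (T : H →ₗ[ℝ] H) μ) = Nat.card (a ⁻¹' {μ}) := by
  have : Fintype (a ⁻¹' {μ}) := hf.fintype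
  have hspan : Module.End.eigenspace (T : H →ₗ[ℝ] H) μ
      = Submodule.span ℝ (Set.range fun i : a ⁻¹' {μ} => b i) := by
    apply le_antisymm
    · intro x hx
      have hx' : T x = μ • x := Module.End.mem_eigenspace_iff.1 hx
      have hi : ∀ i, i ∉ hf.toFinset → b.repr x i • b i = 0 := fun i hi => by
        have h1 : inner ℝ (b i) (T x) = inner ℝ (T (b i)) x := (hT (b i) x).symm
        rw [hx', h, real_inner_smul_left, real_inner_smul_right] at h1
        have h2 : a i ≠ μ := fun hc => hi (by simpa using hc)
        have h3 : (a i - μ) * inner ℝ (b i) x = 0 := by linarith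
        rw [b.repr_apply_apply, (mul_eq_zero.1 h3).resolve_left (sub_ne_zero.2 h2), zero_smul]
      rw [(b.hasSum_repr x).unique (hasSum_sum_of_ne_finset_zero hi)]
      refine Submodule.sum_mem _ fun i hi => Submodule.smul_mem _ _ (Submodule.subset_span ?_)
      exact ⟨⟨i, hf.mem_toFinset.1 hi⟩, rfl⟩
    · rw [Submodule.span_le]
      rintro _ ⟨i, rfl⟩
      refine Module.End.mem_eigenspace_iff.2 ?_
      exact (h i).trans (congrArg (· • b i) (show a i = μ from i.2))
  rw [hspan, finrank_span_eq_card, Nat.card_eq_fintype_card]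
  exact b.orthonormal.linearIndependent.comp _ Subtype.val_injective

/-- The logarithm of the Fredholm determinant as a sum over an eigenbasis. -/
theorem log_detOneAdd_of_eigenbasis (T : H →L[ℝ] H) (b : HilbertBasis ι ℝ H) (a : ι → ℝ)
    (h : ∀ i, T (b i) = a i • b i) (ha : ∀ i, 0 ≤ a i) (hs : Summable a) {L : ℝ}
    (hL : HasSum (fun i => Real.log (1 + a i)) L) : Real.log (detOneAdd T) = L := by
  have hT : (T : H →ₗ[ℝ] H).IsSymmetric := (isPositive_of_eigenbasis T b a h ha).isSymmetric
  have hfin : ∀ μ : {μ : ℝ // μ ≠ 0}, (a ⁻¹' {(μ : ℝ)}).Finite := fun μ => by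
    have h1 := hs.tendsto_cofinite_zero.eventually (isOpen_ne.mem_nhds μ.2.symm)
    refine (Filter.eventually_cofinite.1 h1).subset fun i hi => ?_
    simpa using hi
  -- The product also runs over μ ≤ −1; there the exponent is zero and the factor is 1.
  have hpos : ∀ μ : {μ : ℝ // μ ≠ 0}, 0 < (1 + (μ : ℝ)) ^ Nat.card (a ⁻¹' {(μ : ℝ)}) := fun μ => by
    rcases (a ⁻¹' {(μ : ℝ)}).eq_empty_or_nonempty with he | ⟨i, hi⟩
    · simp [he]
    · have h2 : a i = μ := hi
      have := ha i
      refine pow_pos ?_ _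
      linarith
  let e : {i // a i ≠ 0} → {μ : ℝ // μ ≠ 0} := fun i => ⟨a i, i.2⟩
  have hL' : HasSum (fun i : {i // a i ≠ 0} => Real.log (1 + a i)) L := by
    refine (Function.Injective.hasSum_iff (f := fun i => Real.log (1 + a i))
      Subtype.val_injective fun i hi => ?_).2 hL
    have : a i = 0 := by
      by_contra hne
      exact hi ⟨⟨i, hne⟩, rfl⟩
    simp [this]
  have hfib : ∀ μ, ∑' i : e ⁻¹' {μ}, Real.log (1 + a i)
      = Real.log ((1 + (μ : ℝ)) ^ Nat.card (a ⁻¹' {(μ : ℝ)})) := fun μ => by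
    have h3 : ∀ i : e ⁻¹' {μ}, Real.log (1 + a i) = Real.log (1 + (μ : ℝ)) := fun i => by
      have : a i = μ := congrArg Subtype.val (show e i = μ from i.2)
      rw [this]
    rw [tsum_congr h3, tsum_const, Real.log_pow, nsmul_eq_mul]
    congr 2
    refine Nat.card_congr ⟨fun i => ⟨i, congrArg Subtype.val (show e i = μ from i.2)⟩,
      fun i => ⟨⟨i, by rw [show a i = μ from i.2]; exact μ.2⟩,
        Subtype.ext (show a i = μ from i.2)⟩, fun i => rfl, fun i => rfl⟩
  -- The sum over basis vectors is grouped by eigenvalue, each nonzero one occurring finitely often.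
  have hsum := hL'.tsum_fiberwise e
  simp only [hfib] at hsum
  rw [detOneAdd]
  simp_rw [fun μ : {μ : ℝ // μ ≠ 0} => finrank_eigenspace_of_eigenbasis T b a h hT μ (hfin μ)]
  rw [← Real.rexp_tsum_eq_tprod hpos hsum.summable, Real.log_exp, hsum.tsum_eq]

/-- The entropic Wasserstein distance in terms of the eigenvalues of `A^{1/2} B A^{1/2}`. -/
theorem opW2_of_eigenbasis (ε : ℝ) (A B : H →L[ℝ] H) (b : HilbertBasis ι ℝ H) (a : ι → ℝ)
    (h : ∀ i, posSqrt A (B (posSqrt A (b i))) = a i • b i) (ha : ∀ i, 0 ≤ a i)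
    (hs : Summable a) {S : ℝ} (hS : HasSum (fun i => scalarF (16 / ε ^ 2 * a i)) S) :
    opW2 ε A B = opTrace A + opTrace B - ε / 2 * S := by
  have hM := opM_apply_of_eigenbasis ε A B b a h ha
  set m : ι → ℝ := fun i => √(1 + 16 / ε ^ 2 * a i) - 1 with hm
  have hc : ∀ i, 0 ≤ 16 / ε ^ 2 * a i := fun i => by have := ha i; positivity
  have hm0 : ∀ i, 0 ≤ m i := fun i => sub_nonneg.2 (one_le_sqrt_one_add (hc i))
  have hms : Summable m := by
    refine Summable.of_nonneg_of_le hm0 (fun i => ?_) (hs.mul_left (16 / ε ^ 2))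
    have h1 := Real.sqrt_le_sqrt (show 1 + 16 / ε ^ 2 * a i ≤ (1 + 16 / ε ^ 2 * a i) ^ 2 by
      nlinarith [hc i])
    rw [Real.sqrt_sq (by linarith [hc i])] at h1
    simp only [hm]
    linarith
  -- With m = √(1 + ca) − 1, c = 16/ε², one has 1 + m/2 = ½ + ½√(1 + ca), so log(1 + m/2) = m −
  -- f(ca).
  have hlog : HasSum (fun i => Real.log (1 + 1 / 2 * m i)) (∑' i, m i - S) := by
    refine (hms.hasSum.sub hS).congr_fun fun i => ?_
    rw [scalarF]
    simp only [hm]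
    ring_nf
  rw [opW2, opTrace_of_eigenbasis _ b m hM hm0 hms.hasSum,
    log_detOneAdd_of_eigenbasis ((1 / 2 : ℝ) • opM ε A B) b (fun i => 1 / 2 * m i)
      (fun i => by rw [smul_apply, hM, smul_smul])
      (fun i => by have := hm0 i; positivity) (hms.mul_left _) hlog]
  ring

end Operators

/-! ### Principal square root and the matrix function F -/

section Matrices

open Matrix Polynomial

theorem aeval_semiconj {R A : Type*} [CommRing R] [Ring A] [Algebra R A] {x s r : A}
    (h : r * x = x * s) (p : R[X]) : aeval r p * x = x * aeval s p := by
  induction p using Polynomial.induction_on' with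
  | add p q hp hq => simp only [map_add, add_mul, mul_add, hp, hq]
  | monomial n a =>
    have hn : SemiconjBy x (s ^ n) (r ^ n) := SemiconjBy.pow_right h.symm n
    rw [aeval_monomial, aeval_monomial, mul_assoc, ← hn.eq, ← mul_assoc, ← mul_assoc,
      Algebra.commutes]

variable {n : ℕ}

/-- Uniqueness of the principal square root. -/
theorem eq_of_mul_self_eq_of_re_pos {R S : Matrix (Fin n) (Fin n) ℂ} (h : R * R = S * S)
    (hR : ∀ z ∈ spectrum ℂ R, 0 < z.re) (hS : ∀ z ∈ spectrum ℂ S, 0 < z.re) : R = S := by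
  -- Sylvester's argument: R − S intertwines R with −S, whose spectra are disjoint. The
  -- characteristic polynomial of R vanishes at R and is invertible at −S, forcing R − S = 0.
  have hx : R * (R - S) = (R - S) * (-S) := by
    rw [mul_sub, sub_mul, mul_neg, mul_neg, h]
    abel
  have h1 := aeval_semiconj hx R.charpoly
  rw [aeval_self_charpoly, zero_mul] at h1
  have hu : IsUnit (aeval (-S) R.charpoly) := by
    by_contra hnu
    rw [(IsAlgClosed.splits R.charpoly).eq_prod_roots_of_monic R.charpoly_monic] at hnu
    obtain ⟨k, hk, hk'⟩ := spectrum.exists_mem_of_not_isUnit_aeval_prod hnu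
    rw [← spectrum.neg_eq, Set.mem_neg] at hk
    have h2 := hS _ hk
    have h3 := hR k (mem_spectrum_iff_isRoot_charpoly.2 hk')
    rw [Complex.neg_re] at h2
    linarith
  obtain ⟨u, hu⟩ := hu
  rw [← hu] at h1
  have := congrArg (· * (↑u⁻¹ : Matrix (Fin n) (Fin n) ℂ)) h1.symm
  simpa [mul_assoc, sub_eq_zero] using this

theorem principalSqrt_eq {A R : Matrix (Fin n) (Fin n) ℝ} (h : R * R = A)
    (hR : ∀ z ∈ spectrum ℂ (R.map Complex.ofReal), 0 < z.re) : principalSqrt A = R := by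
  have hex : ∃ R : Matrix (Fin n) (Fin n) ℝ, R * R = A ∧
      ∀ z ∈ spectrum ℂ (R.map Complex.ofReal), 0 < z.re := ⟨R, h, hR⟩
  rw [principalSqrt, dif_pos hex]
  obtain ⟨h1, h2⟩ := hex.choose_spec
  have h3 := eq_of_mul_self_eq_of_re_pos (R := hex.choose.map Complex.ofReal)
    (S := R.map Complex.ofReal) (by
      have : ∀ M : Matrix (Fin n) (Fin n) ℝ,
          M.map Complex.ofReal * M.map Complex.ofReal = (M * M).map Complex.ofReal := fun M =>
        (Matrix.map_mul (f := Complex.ofRealHom)).symm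
      rw [this, this, h1, h]) h2 hR
  exact Matrix.map_injective Complex.ofReal_injective h3

/-- The value of `F` at a product of the form `c YᵀY Σ`, in terms of the eigenvalues of
`Y Σ Yᵀ`. -/
theorem matF_smul_transpose_mul_mul (Y T : Matrix (Fin n) (Fin n) ℝ)
    (hB : (Y * T * Yᵀ).PosSemidef) {c : ℝ} (hc : 0 ≤ c) :
    matF (c • (Yᵀ * Y * T)) = ∑ i, scalarF (c * hB.1.eigenvalues i) := by
  set l := hB.1.eigenvalues with hl
  have hl0 : ∀ i, 0 ≤ c * l i := fun i => mul_nonneg hc (hB.eigenvalues_nonneg i)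
  set U : Matrix (Fin n) (Fin n) ℝ := hB.1.eigenvectorUnitary.val with hU
  set V : Matrix (Fin n) (Fin n) ℝ := star U with hV
  have hVU : V * U = 1 := Unitary.coe_star_mul_self hB.1.eigenvectorUnitary
  have hUV : U * V = 1 := Unitary.coe_mul_star_self hB.1.eigenvectorUnitary
  have hBd : Y * T * Yᵀ = U * diagonal l * V := by
    have := hB.1.spectral_theorem
    rwa [Unitary.conjStarAlgAut_apply] at this
  have hDmul : ∀ d e : Fin n → ℝ,
      (U * diagonal d * V) * (U * diagonal e * V) = U * diagonal (fun i => d i * e i) * V := by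
    intro d e
    rw [← diagonal_mul_diagonal]
    calc (U * diagonal d * V) * (U * diagonal e * V)
        = U * diagonal d * (V * U) * diagonal e * V := by simp only [mul_assoc]
      _ = _ := by rw [hVU, mul_one]; simp only [mul_assoc]
  set q : Fin n → ℝ := fun i => √(1 + c * l i) with hq
  have hq1 : ∀ i, 1 ≤ q i := fun i => one_le_sqrt_one_add (hl0 i)
  have hq2 : ∀ i, q i ^ 2 = 1 + c * l i := fun i => Real.sq_sqrt (by linarith [hl0 i])
  -- YᵀYT need not be symmetric, but B = YTYᵀ is. From √(1+t) − 1 = t/(1 + √(1+t)), with N = (1 +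
  -- √(1 + cB))⁻¹, one gets √(1 + cB) = 1 + WX; moving Yᵀ across makes 1 + XW the root of 1 + cYᵀYT.
  set N : Matrix (Fin n) (Fin n) ℝ := U * diagonal (fun i => (1 + q i)⁻¹) * V with hN
  set X : Matrix (Fin n) (Fin n) ℝ := c • (Yᵀ * N) with hX
  set W : Matrix (Fin n) (Fin n) ℝ := Y * T with hW
  have hWX : W * X = U * diagonal (fun i => q i - 1) * V := by
    calc W * X = c • ((Y * T * Yᵀ) * N) := by simp [hW, hX, mul_assoc]
      _ = U * diagonal (fun i => q i - 1) * V := by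
        rw [hBd, hN, hDmul, ← Matrix.smul_mul, ← Matrix.mul_smul, ← diagonal_smul]
        congr 3
        funext i
        have := hq1 i
        have := hq2 i
        simp only [Pi.smul_apply, smul_eq_mul]
        field_simp
        nlinarith
  have hNW : 2 • N + N * (W * X) = 1 := by
    rw [hWX, hN, hDmul, ← Matrix.smul_mul, ← Matrix.mul_smul, ← diagonal_smul, ← Matrix.add_mul,
      ← Matrix.mul_add, diagonal_add]
    rw [show (fun i => (2 • fun i => (1 + q i)⁻¹) i + (1 + q i)⁻¹ * (q i - 1)) = fun _ => (1 : ℝ) by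
      funext i
      have := hq1 i
      simp only [Pi.smul_apply, nsmul_eq_mul]
      push_cast
      field_simp
      ring]
    rw [diagonal_one, mul_one, hUV]
  have hsq : (1 + X * W) * (1 + X * W) = 1 + c • (Yᵀ * Y * T) := by
    have h1 : (1 + X * W) * (1 + X * W) = 1 + (2 • X + X * (W * X)) * W := by noncomm_ring
    have h2 : 2 • X + X * (W * X) = c • (Yᵀ * (2 • N + N * (W * X))) := by
      simp only [hX, Matrix.mul_add, smul_add, Matrix.smul_mul, Matrix.mul_assoc, Matrix.mul_smul]
      rw [smul_comm]
    rw [h1, h2, hNW, mul_one, Matrix.smul_mul, hW, mul_assoc]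
  -- XW and WX share their characteristic polynomial, so the spectrum can be read off the symmetric
  -- WX.
  have hchar : (X * W).charpoly = ∏ i, (Polynomial.X - C (q i - 1)) := by
    rw [charpoly_mul_comm, hWX, charpoly_mul_comm, ← mul_assoc, hVU, one_mul, charpoly_diagonal]
  have hspec : ∀ z ∈ spectrum ℂ ((1 + X * W).map Complex.ofReal), 0 < z.re := by
    intro z hz
    have h1 : (1 + X * W).map Complex.ofReal
        = algebraMap ℂ (Matrix (Fin n) (Fin n) ℂ) 1 + (X * W).map Complex.ofReal := by
      rw [map_one, Matrix.map_add _ Complex.ofReal_add]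
      congr 1
      exact Matrix.map_one _ Complex.ofReal_zero Complex.ofReal_one
    rw [h1, ← spectrum.singleton_add_eq] at hz
    obtain ⟨_, rfl, y, hy, rfl⟩ := Set.mem_add.1 hz
    rw [mem_spectrum_iff_isRoot_charpoly,
      show (X * W).map Complex.ofReal = (X * W).map Complex.ofRealHom from rfl, charpoly_map, hchar,
      Polynomial.map_prod, IsRoot.def, eval_prod, Finset.prod_eq_zero_iff] at hy
    obtain ⟨i, -, hi⟩ := hy
    have hy : y = ((q i - 1 : ℝ) : ℂ) := by
      simpa [sub_eq_zero] using hi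
    have := hq1 i
    rw [hy, Complex.add_re, Complex.one_re, Complex.ofReal_re]
    linarith
  have htr : (X * W).trace = ∑ i, (q i - 1) := by
    rw [trace_mul_comm, hWX, trace_mul_comm, ← mul_assoc, hVU, one_mul, trace_diagonal]
  have hdet : ((1 / 2 : ℝ) • (1 : Matrix (Fin n) (Fin n) ℝ) + (1 / 2 : ℝ) • (1 + X * W)).det
      = ∏ i, (1 / 2 + 1 / 2 * q i) := by
    have h1 : (1 / 2 : ℝ) • (1 : Matrix (Fin n) (Fin n) ℝ) + (1 / 2 : ℝ) • (1 + X * W)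
        = 1 + ((1 / 2 : ℝ) • X) * W := by
      rw [smul_add, ← add_assoc, ← add_smul, Matrix.smul_mul]
      norm_num [hX]
    have h2 : 1 + W * ((1 / 2 : ℝ) • X) = U * diagonal (fun i => 1 / 2 + 1 / 2 * q i) * V := by
      rw [Matrix.mul_smul, hWX, ← hUV, ← Matrix.smul_mul, ← Matrix.mul_smul, ← diagonal_smul]
      nth_rewrite 1 [← mul_one U]
      rw [← Matrix.add_mul, ← Matrix.mul_add, ← diagonal_one, diagonal_add]
      congr 3
      funext i
      simp only [Pi.smul_apply, smul_eq_mul]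
      ring
    rw [h1, det_one_add_mul_comm, h2, det_mul_comm, ← mul_assoc, hVU, one_mul, det_diagonal]
  rw [matF, principalSqrt_eq hsq hspec, hdet, neg_add_cancel_left, htr,
    Real.log_prod fun i _ => by have := hq1 i; positivity, ← Finset.sum_sub_distrib]
  rfl

end Matrices

/-! ### Pinelis' inequality -/

section Concentration

variable {X : Type*} [MeasurableSpace X] {E : Type*} [NormedAddCommGroup E]
  [InnerProductSpace ℝ E] [CompleteSpace E]

theorem lintegral_cosh_norm_add_le (ρ : Measure X) [IsProbabilityMeasure ρ] {ξ : X → E}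
    (hξ : StronglyMeasurable ξ) {b : ℝ} (hb : ∀ x, ‖ξ x‖ ≤ b) (h0 : ∫ x, ξ x ∂ρ = 0)
    (l : ℝ) (v : E) :
    ∫⁻ x, ENNReal.ofReal (Real.cosh (l * ‖v + ξ x‖)) ∂ρ
      ≤ ENNReal.ofReal (Real.cosh (l * ‖v‖) * Real.cosh (l * b)) := by
  obtain ⟨C, hC⟩ := exists_cosh_norm_add_le l b v
  have hi : Integrable ξ ρ := Integrable.of_bound hξ.aestronglyMeasurable b (.of_forall hb)
  have hi' : Integrable (fun x => Real.cosh (l * ‖v‖) * Real.cosh (l * b) + C * inner ℝ v (ξ x)) ρ :=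
    (integrable_const _).add ((hi.const_inner v).const_mul C)
  calc ∫⁻ x, ENNReal.ofReal (Real.cosh (l * ‖v + ξ x‖)) ∂ρ
      ≤ ∫⁻ x, ENNReal.ofReal (Real.cosh (l * ‖v‖) * Real.cosh (l * b) + C * inner ℝ v (ξ x)) ∂ρ :=
        lintegral_mono fun x => ENNReal.ofReal_le_ofReal (hC _ (hb x))
    _ = ENNReal.ofReal
        (∫ x, (Real.cosh (l * ‖v‖) * Real.cosh (l * b) + C * inner ℝ v (ξ x)) ∂ρ) := by
        rw [ofReal_integral_eq_lintegral_ofReal hi']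
        exact .of_forall fun x => (Real.cosh_pos _).le.trans (hC _ (hb x))
    _ = _ := by
        rw [integral_add (integrable_const _) ((hi.const_inner v).const_mul C),
          integral_const_mul C, integral_inner hi, h0]
        simp

/-- The offset `v` makes the induction work: the first summand is absorbed into it, the remaining
ones are integrated out, then the one-step bound applies. -/
theorem lintegral_cosh_norm_sum_le (ρ : Measure X) [IsProbabilityMeasure ρ] {ξ : X → E}
    (hξ : StronglyMeasurable ξ) {b : ℝ} (hb : ∀ x, ‖ξ x‖ ≤ b) (h0 : ∫ x, ξ x ∂ρ = 0)
    (l : ℝ) (n : ℕ) (v : E) :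
    ∫⁻ x, ENNReal.ofReal (Real.cosh (l * ‖v + ∑ j, ξ (x j)‖)) ∂(Measure.pi fun _ : Fin n => ρ)
      ≤ ENNReal.ofReal (Real.cosh (l * ‖v‖) * Real.cosh (l * b) ^ n) := by
  induction n generalizing v with
  | zero => simp
  | succ n ih =>
    have hmp := measurePreserving_piFinSuccAbove (fun _ : Fin (n + 1) => ρ) 0
    set F : X × (Fin n → X) → ℝ≥0∞ := fun p =>
      ENNReal.ofReal (Real.cosh (l * ‖v + ξ p.1 + ∑ j, ξ (p.2 j)‖)) with hF
    have hFm : Measurable F := by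
      have h1 : StronglyMeasurable fun p : X × (Fin n → X) => v + ξ p.1 + ∑ j, ξ (p.2 j) := by
        refine (stronglyMeasurable_const.add (hξ.comp_measurable measurable_fst)).add ?_
        exact Finset.stronglyMeasurable_fun_sum _ fun j _ =>
          hξ.comp_measurable ((measurable_pi_apply j).comp measurable_snd)
      exact (Real.continuous_cosh.measurable.comp (h1.norm.measurable.const_mul l)).ennreal_ofReal
    calc ∫⁻ x, ENNReal.ofReal (Real.cosh (l * ‖v + ∑ j, ξ (x j)‖))
          ∂(Measure.pi fun _ : Fin (n + 1) => ρ)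
        = ∫⁻ x, F (MeasurableEquiv.piFinSuccAbove (fun _ => X) 0 x)
          ∂(Measure.pi fun _ : Fin (n + 1) => ρ) := by
          refine lintegral_congr fun x => ?_
          simp [hF, Fin.sum_univ_succ, add_assoc, Fin.tail]
      _ = ∫⁻ p, F p ∂(ρ.prod (Measure.pi fun _ : Fin n => ρ)) := hmp.lintegral_comp hFm
      _ = ∫⁻ x, ∫⁻ y, F (x, y) ∂(Measure.pi fun _ : Fin n => ρ) ∂ρ :=
          lintegral_prod _ hFm.aemeasurable
      _ ≤ ∫⁻ x, ENNReal.ofReal (Real.cosh (l * ‖v + ξ x‖) * Real.cosh (l * b) ^ n) ∂ρ :=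
          lintegral_mono fun x => ih (v + ξ x)
      _ = (∫⁻ x, ENNReal.ofReal (Real.cosh (l * ‖v + ξ x‖)) ∂ρ)
          * ENNReal.ofReal (Real.cosh (l * b) ^ n) := by
          rw [← lintegral_mul_const']
          · simp_rw [ENNReal.ofReal_mul (Real.cosh_pos _).le]
          · finiteness
      _ ≤ ENNReal.ofReal (Real.cosh (l * ‖v‖) * Real.cosh (l * b))
          * ENNReal.ofReal (Real.cosh (l * b) ^ n) := by
          gcongr
          exact lintegral_cosh_norm_add_le ρ hξ hb h0 l v
      _ = _ := by
          rw [← ENNReal.ofReal_mul (by positivity), mul_assoc, ← pow_succ']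

/-- Pinelis' inequality for sums of bounded centred i.i.d. random vectors in a Hilbert space. -/
theorem pi_norm_sum_gt_le (ρ : Measure X) [IsProbabilityMeasure ρ] {ξ : X → E}
    (hξ : StronglyMeasurable ξ) {b : ℝ} (hb : ∀ x, ‖ξ x‖ ≤ b) (h0 : ∫ x, ξ x ∂ρ = 0)
    (n : ℕ) (hn : 1 ≤ n) {θ : ℝ} (hθ : 0 ≤ θ) :
    (Measure.pi fun _ : Fin n => ρ) {x | b * √(2 * θ * n) < ‖∑ j, ξ (x j)‖}
      ≤ ENNReal.ofReal (2 * Real.exp (-θ)) := by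
  have hX : Nonempty X := ρ.nonempty_of_neZero
  have hb0 : 0 ≤ b := (norm_nonneg _).trans (hb hX.some)
  rcases hb0.eq_or_lt with rfl | hb0
  · have : ∀ x, ξ x = 0 := fun x => norm_le_zero_iff.1 (hb x)
    simp [this]
  have hn0 : (0 : ℝ) < n := by exact_mod_cast hn
  -- Minimizer of n(lb)²/2 − lt at t = b√(2θn). There cosh(lb)^n ≤ e^θ, while cosh(lt) ≥ e^{2θ}/2,
  -- so Markov yields 2e^{-θ}.
  set l := √(2 * θ / n) / b with hl
  have hl0 : 0 ≤ l := by positivity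
  have h1 := lintegral_cosh_norm_sum_le ρ hξ hb h0 l n 0
  simp only [zero_add, norm_zero, mul_zero, Real.cosh_zero, one_mul] at h1
  have hsq : √(2 * θ / n) * √(2 * θ * n) = 2 * θ := by
    rw [← Real.sqrt_mul (by positivity), show 2 * θ / n * (2 * θ * n) = (2 * θ) ^ 2 by
      field_simp, Real.sqrt_sq (by positivity)]
  have hlt : l * (b * √(2 * θ * n)) = 2 * θ := by
    rw [hl, ← mul_assoc, div_mul_cancel₀ _ hb0.ne', hsq]
  have hcosh : Real.cosh (l * b) ^ n ≤ Real.exp θ := by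
    calc Real.cosh (l * b) ^ n ≤ Real.exp ((l * b) ^ 2 / 2) ^ n := by
          gcongr
          exact Real.cosh_le_exp_half_sq _
      _ = Real.exp θ := by
          rw [← Real.exp_nat_mul, hl, div_mul_cancel₀ _ hb0.ne', Real.sq_sqrt (by positivity)]
          congr 1
          field_simp
  have hmeas : Measurable fun x : Fin n → X =>
      ENNReal.ofReal (Real.cosh (l * ‖∑ j, ξ (x j)‖)) := by
    have h2 : StronglyMeasurable fun x : Fin n → X => ∑ j, ξ (x j) :=
      Finset.stronglyMeasurable_fun_sum _ fun j _ => hξ.comp_measurable (measurable_pi_apply j)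
    exact (Real.continuous_cosh.measurable.comp (h2.norm.measurable.const_mul l)).ennreal_ofReal
  have hmarkov := mul_meas_ge_le_lintegral (μ := Measure.pi fun _ : Fin n => ρ) hmeas
    (ENNReal.ofReal (Real.exp (2 * θ) / 2))
  have hsub : {x : Fin n → X | b * √(2 * θ * n) < ‖∑ j, ξ (x j)‖} ⊆
      {x | ENNReal.ofReal (Real.exp (2 * θ) / 2)
        ≤ ENNReal.ofReal (Real.cosh (l * ‖∑ j, ξ (x j)‖))} := by
    intro x hx
    refine ENNReal.ofReal_le_ofReal ?_
    have h3 : 2 * θ ≤ l * ‖∑ j, ξ (x j)‖ := by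
      rw [← hlt]
      exact mul_le_mul_of_nonneg_left (le_of_lt hx) hl0
    rw [Real.cosh_eq]
    have := Real.exp_le_exp.2 h3
    have := Real.exp_pos (-(l * ‖∑ j, ξ (x j)‖))
    linarith
  have h4 : ENNReal.ofReal (Real.exp (2 * θ) / 2) *
      (Measure.pi fun _ : Fin n => ρ) {x | b * √(2 * θ * n) < ‖∑ j, ξ (x j)‖}
      ≤ ENNReal.ofReal (Real.exp θ) :=
    (mul_le_mul_right (measure_mono hsub) _).trans
      (hmarkov.trans (h1.trans (ENNReal.ofReal_le_ofReal hcosh)))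
  have hp : 0 < Real.exp (2 * θ) / 2 := by positivity
  rw [mul_comm, ← ENNReal.le_div_iff_mul_le (Or.inl (by simpa using hp)) (Or.inl (by finiteness)),
    ← ENNReal.ofReal_div_of_pos hp] at h4
  refine h4.trans (le_of_eq ?_)
  congr 1
  rw [Real.exp_neg, show 2 * θ = θ + θ by ring, Real.exp_add]
  field_simp

end Concentration

/-! ### Feature maps from reproducing kernel Hilbert spaces -/

section Feature

universe u

/-- Orthonormal vectors lie √2 apart. Countability later permits exchanging basis sums with
integrals. -/
theorem countable_of_orthonormal {ι H : Type*} [NormedAddCommGroup H]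
    [InnerProductSpace ℝ H] [TopologicalSpace.SeparableSpace H] {v : ι → H}
    (hv : Orthonormal ℝ v) : Countable ι := by
  have hd : Pairwise fun i j => 1 ≤ dist (v i) (v j) := fun i j hij => by
    have h : ‖v i - v j‖ ^ 2 = 2 := by
      rw [norm_sub_sq_real, hv.1, hv.1, hv.2 hij]; norm_num
    change 1 ≤ dist (v i) (v j)
    rw [dist_eq_norm]
    nlinarith [norm_nonneg (v i - v j)]
  have hd' : Pairwise fun i j : Set.range v => 1 ≤ dist i j := by
    rintro ⟨_, i, rfl⟩ ⟨_, j, rfl⟩ hij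
    exact hd fun h => hij (by rw [h])
  have := DiscreteTopology.of_forall_le_dist one_pos hd'
  have := UniformSpace.secondCountable_of_separable H
  have hc : Countable (Set.range v) := countable_of_Lindelof_of_discrete
  exact (Equiv.ofInjective v hv.linearIndependent.injective).injective.countable

/-- φ(x) is the kernel section at x. Expanding ‖φ y − φ x‖² in K gives continuity; separability
follows since the sections, a continuous image of a compact space, span a dense subspace. -/
theorem exists_feature_hilbertSpace {X : Type u} [MetricSpace X] [CompactSpace X]
    (K : C(X × X, ℝ)) (hK : IsCovarianceKernel K) :
    ∃ (H : Type u) (_ : NormedAddCommGroup H) (_ : InnerProductSpace ℝ H) (_ : CompleteSpace H)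
      (ι : Type u) (_ : Countable ι) (_ : HilbertBasis ι ℝ H) (φ : C(X, H)),
      ∀ x y, inner ℝ (φ x) (φ y) = K (x, y) := by
  have hsymm : ∀ x y, K (x, y) = K (y, x) := fun x y => by
    have := (hK 2 ![x, y]).isHermitian.apply 1 0
    simpa using this
  let M : Matrix X X (ℝ →L[ℝ] ℝ) := .of fun x y => K (x, y) • ContinuousLinearMap.id ℝ ℝ
  have hM : M.PosSemidef := by
    have htfae := (RKHS.posSemidef_tfae (K := M)).out 0 2
    rw [htfae]
    refine ⟨?_, fun v => ?_⟩
    · ext x y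
      simp [M, hsymm x y, ContinuousLinearMap.star_eq_adjoint,
        show ContinuousLinearMap.adjoint (ContinuousLinearMap.id ℝ ℝ) = .id ℝ ℝ from star_one _]
    · let e := v.support.equivFin.symm
      have hsum : ∀ g : X → ℝ, ∑ x ∈ v.support, g x = ∑ i, g (e i) := fun g => by
        rw [← Finset.sum_coe_sort, ← e.sum_comp]
      have h := (hK _ fun i => (e i : X)).dotProduct_mulVec_nonneg fun i => v (e i)
      refine h.trans_eq ?_
      simp only [Finsupp.sum, hsum, dotProduct, Matrix.mulVec, Finset.mul_sum, RCLike.re_to_real]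
      rw [Finset.sum_comm]
      refine Finset.sum_congr rfl fun i _ => Finset.sum_congr rfl fun j _ => ?_
      simp [M]
  have : Fact M.PosSemidef := ⟨hM⟩
  let H := RKHS.OfKernel M
  let ψ : X → H := fun x => RKHS.kerFun H x 1
  have hψ : ∀ x y, inner ℝ (ψ x) (ψ y) = K (x, y) := fun x y => by
    simp only [ψ]
    rw [RKHS.kerFun_inner, RKHS.kerFun_apply, RKHS.OfKernel.kernel_ofKernel]
    simp [M]
  have hcont : Continuous ψ := by
    rw [continuous_iff_continuousAt]
    intro x
    rw [ContinuousAt, tendsto_iff_norm_sub_tendsto_zero]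
    have h1 : ∀ y, ‖ψ y - ψ x‖ = √(K (y, y) - 2 * K (y, x) + K (x, x)) := fun y => by
      rw [← hψ, ← hψ, ← hψ, real_inner_self_eq_norm_sq, real_inner_self_eq_norm_sq,
        ← norm_sub_sq_real, Real.sqrt_sq (norm_nonneg _)]
    simp_rw [h1]
    have h2 : Continuous fun y => √(K (y, y) - 2 * K (y, x) + K (x, x)) := by fun_prop
    have h3 := h2.tendsto x
    rwa [show K (x, x) - 2 * K (x, x) + K (x, x) = 0 by ring, Real.sqrt_zero] at h3
  have hsep : TopologicalSpace.SeparableSpace H := by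
    rw [← TopologicalSpace.isSeparable_univ_iff]
    have h1 := (TopologicalSpace.isSeparable_range hcont).span (R := ℝ) |>.closure
    refine h1.mono ?_
    have h2 := RKHS.kerFun_dense (𝕜 := ℝ) (V := ℝ) (X := X) H
    intro z _
    have hz : z ∈ (Submodule.span ℝ {x | ∃ y v, (RKHS.kerFun H y) v = x}).topologicalClosure := by
      rw [h2]; trivial
    refine closure_mono ?_ hz
    refine Submodule.span_le.2 ?_
    rintro _ ⟨y, v, rfl⟩
    have : RKHS.kerFun H y v = v • ψ y := by
      simp only [ψ]
      rw [← map_smul]; simp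
    rw [this]
    exact Submodule.smul_mem _ _ (Submodule.subset_span ⟨y, rfl⟩)
  obtain ⟨w, b, -⟩ := exists_hilbertBasis ℝ H
  exact ⟨H, inferInstance, inferInstance, inferInstance, w,
    countable_of_orthonormal b.orthonormal, b, ⟨ψ, hcont⟩, hψ⟩

end Feature

/-! ### Factorization of the covariance operator -/

section Analysis

variable {X : Type*} [MetricSpace X] [CompactSpace X] [MeasurableSpace X] [BorelSpace X]
  {ι : Type*} {H : Type*} [NormedAddCommGroup H] [InnerProductSpace ℝ H]

/-- The map `h ↦ ⟪φ(·), h⟫` into continuous functions. -/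
noncomputable def featureEval (φ : C(X, H)) : H →L[ℝ] C(X, ℝ) :=
  LinearMap.mkContinuous
    { toFun := fun h => ⟨fun x => inner ℝ (φ x) h, by fun_prop⟩
      map_add' := fun h h' => by ext x; simp [inner_add_right]
      map_smul' := fun c h => by ext x; simp [inner_smul_right] } ‖φ‖ fun h =>
    (ContinuousMap.norm_le _ (by positivity)).2 fun x =>
      (norm_inner_le_norm _ _).trans (by gcongr; exact φ.norm_coe_le_norm x)

/-- The analysis operator `h ↦ ⟪φ(·), h⟫` of a continuous feature map, into `L²(ρ)`. -/
noncomputable def analysisOp (ρ : Measure X) [IsProbabilityMeasure ρ] (φ : C(X, H)) :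
    H →L[ℝ] Lp ℝ 2 ρ :=
  (ContinuousMap.toLp 2 ρ ℝ) ∘L featureEval φ

variable (ρ : Measure X) [IsProbabilityMeasure ρ]

theorem integrable_of_continuousMap {E : Type*} [NormedAddCommGroup E] (φ : C(X, E)) :
    Integrable φ ρ :=
  Integrable.of_bound φ.continuous.aestronglyMeasurable ‖φ‖
    (.of_forall fun x => φ.norm_coe_le_norm x)

theorem inner_analysisOp (φ : C(X, H)) (g : Lp ℝ 2 ρ) (h : H) :
    inner ℝ g (analysisOp ρ φ h) = ∫ x, g x * inner ℝ (φ x) h ∂ρ := by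
  rw [L2.inner_def]
  refine integral_congr_ae ?_
  filter_upwards [ContinuousMap.coeFn_toLp (p := 2) (𝕜 := ℝ) ρ (featureEval φ h)] with x hx
  rw [analysisOp, ContinuousLinearMap.comp_apply, hx]
  simp [featureEval, mul_comm]

theorem inner_analysisOp_analysisOp {H' : Type*} [NormedAddCommGroup H'] [InnerProductSpace ℝ H']
    (φ : C(X, H)) (φ' : C(X, H')) (h : H) (h' : H') :
    inner ℝ (analysisOp ρ φ h) (analysisOp ρ φ' h')
      = ∫ x, inner ℝ (φ x) h * inner ℝ (φ' x) h' ∂ρ := by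
  rw [inner_analysisOp]
  refine integral_congr_ae ?_
  filter_upwards [ContinuousMap.coeFn_toLp (p := 2) (𝕜 := ℝ) ρ (featureEval φ h)] with x hx
  rw [analysisOp, ContinuousLinearMap.comp_apply, hx]
  simp [featureEval]

variable [CompleteSpace H]

omit [CompleteSpace H] in
theorem integrable_smul_feature (φ : C(X, H)) (g : Lp ℝ 2 ρ) :
    Integrable (fun x => g x • φ x) ρ := by
  have hg : Integrable g ρ := (Lp.memLp g).integrable (by norm_num)
  exact hg.smul_bdd ‖φ‖ φ.continuous.aestronglyMeasurable (.of_forall fun x => φ.norm_coe_le_norm x)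

theorem adjoint_analysisOp_apply (φ : C(X, H)) (g : Lp ℝ 2 ρ) :
    (analysisOp ρ φ).adjoint g = ∫ x, g x • φ x ∂ρ := by
  refine ext_inner_right ℝ fun h => ?_
  rw [ContinuousLinearMap.adjoint_inner_left, inner_analysisOp, real_inner_comm,
    ← integral_inner (integrable_smul_feature ρ φ g)]
  refine integral_congr_ae (.of_forall fun x => ?_)
  simp only [real_inner_smul_right, real_inner_comm]

theorem covOp_eq_analysisOp_comp_adjoint (K : C(X × X, ℝ)) (φ : C(X, H))
    (hφ : ∀ x y, inner ℝ (φ x) (φ y) = K (x, y)) :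
    covOp ρ K = analysisOp ρ φ ∘L (analysisOp ρ φ).adjoint := by
  ext1 g
  rw [ContinuousLinearMap.comp_apply, adjoint_analysisOp_apply, analysisOp, covOp,
    ContinuousLinearMap.comp_apply, ContinuousLinearMap.comp_apply]
  congr 1
  ext x
  simp only [LinearMap.mkContinuous_apply, integralMap, featureEval, LinearMap.coe_mk,
    AddHom.coe_mk, ContinuousMap.coe_mk]
  rw [← integral_inner (integrable_smul_feature ρ φ g)]
  refine integral_congr_ae (.of_forall fun s => ?_)
  simp only [real_inner_smul_right, hφ, mul_comm]

omit [CompleteSpace H] in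
theorem hsSq_analysisOp [Countable ι] (e : HilbertBasis ι ℝ H) (φ : C(X, H)) :
    hsSq e (analysisOp ρ φ) = ENNReal.ofReal (∫ x, ‖φ x‖ ^ 2 ∂ρ) := by
  have hm : ∀ i, Continuous fun x => inner ℝ (e i) (φ x) := fun i => by fun_prop
  calc hsSq e (analysisOp ρ φ) = ∑' i, ∫⁻ x, ‖inner ℝ (e i) (φ x)‖ₑ ^ 2 ∂ρ := by
        refine tsum_congr fun i => ?_
        rw [enorm_sq_eq_ofReal, ← real_inner_self_eq_norm_sq, inner_analysisOp_analysisOp,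
          ofReal_integral_eq_lintegral_ofReal]
        · refine lintegral_congr fun x => ?_
          rw [enorm_sq_eq_ofReal, Real.norm_eq_abs, sq_abs, real_inner_comm, sq]
        · exact integrable_of_continuousMap ρ ⟨fun x => inner ℝ (φ x) (e i) * inner ℝ (φ x) (e i),
            by fun_prop⟩
        · exact .of_forall fun x => mul_self_nonneg _
    _ = ∫⁻ x, ∑' i, ‖inner ℝ (e i) (φ x)‖ₑ ^ 2 ∂ρ := by
        rw [lintegral_tsum]
        intro i
        exact ((hm i).enorm.measurable.pow_const 2).aemeasurable
    _ = ∫⁻ x, ENNReal.ofReal (‖φ x‖ ^ 2) ∂ρ := by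
        simp_rw [tsum_enorm_inner_sq e, enorm_sq_eq_ofReal]
    _ = _ := by
        rw [ofReal_integral_eq_lintegral_ofReal]
        · exact integrable_of_continuousMap ρ ⟨fun x => ‖φ x‖ ^ 2, by fun_prop⟩
        · exact .of_forall fun x => sq_nonneg _

theorem opTrace_covOp [Countable ι] (e : HilbertBasis ι ℝ H) (K : C(X × X, ℝ)) (φ : C(X, H))
    (hφ : ∀ x y, inner ℝ (φ x) (φ y) = K (x, y)) :
    opTrace (covOp ρ K) = ∫ x, K (x, x) ∂ρ := by
  rw [covOp_eq_analysisOp_comp_adjoint ρ K φ hφ, opTrace_comp_adjoint _ e,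
    hsSq_analysisOp, ENNReal.toReal_ofReal (integral_nonneg fun x => sq_nonneg _)]
  · refine integral_congr_ae (.of_forall fun x => ?_)
    simp only [← hφ, real_inner_self_eq_norm_sq]
  · rw [hsSq_analysisOp]; finiteness

/-- Rules out the default value 0 of `posSqrt`: the covariance operator has a Hilbert–Schmidt
factor, so it is compact and can be diagonalized. -/
theorem posSqrt_covOp_spec [Countable ι] (e : HilbertBasis ι ℝ H) (K : C(X × X, ℝ)) (φ : C(X, H))
    (hφ : ∀ x y, inner ℝ (φ x) (φ y) = K (x, y)) :
    (posSqrt (covOp ρ K)).IsPositive ∧ posSqrt (covOp ρ K) * posSqrt (covOp ρ K) = covOp ρ K := by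
  refine posSqrt_spec ?_
  have hp : (covOp ρ K).IsPositive := by
    rw [covOp_eq_analysisOp_comp_adjoint ρ K φ hφ]
    exact ContinuousLinearMap.isPositive_self_comp_adjoint _
  have hc : IsCompactOperator (covOp ρ K) := by
    rw [covOp_eq_analysisOp_comp_adjoint ρ K φ hφ]
    exact (isCompactOperator_of_hsSq_ne_top e (analysisOp ρ φ)
      (by rw [hsSq_analysisOp]; finiteness)).comp_clm _
  obtain ⟨κ, b, a, h⟩ := exists_eigenbasis _ hc hp.isSymmetric
  obtain ⟨R, -, hR⟩ := exists_sqrt_of_eigenbasis _ b a h fun i =>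
    eigenvalue_nonneg_of_isPositive hp h i
  exact ⟨R, hR⟩

end Analysis

/-! ### Population distance through the cross-covariance operator -/

section Population

universe v

variable {X : Type*} [MetricSpace X] [CompactSpace X] [MeasurableSpace X] [BorelSpace X]
  (ρ : Measure X) [IsProbabilityMeasure ρ]
  {ι₀ ι₁ : Type*} {H₀ : Type*} {H₁ : Type v} [NormedAddCommGroup H₀] [InnerProductSpace ℝ H₀]
  [CompleteSpace H₀] [NormedAddCommGroup H₁] [InnerProductSpace ℝ H₁] [CompleteSpace H₁]

/-- The cross-covariance operator `h ↦ ∫ ⟪φ₁(x), h⟫ φ₀(x) dρ(x)`. -/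
noncomputable def crossOp (φ₀ : C(X, H₀)) (φ₁ : C(X, H₁)) : H₁ →L[ℝ] H₀ :=
  (analysisOp ρ φ₀).adjoint ∘L analysisOp ρ φ₁

/-- The entropic distance in terms of the singular values of the cross-covariance operator. -/
theorem exists_eigenbasis_opW2 [Countable ι₀] [Countable ι₁] (e₀ : HilbertBasis ι₀ ℝ H₀)
    (e₁ : HilbertBasis ι₁ ℝ H₁) (K₀ K₁ : C(X × X, ℝ)) (φ₀ : C(X, H₀)) (φ₁ : C(X, H₁))
    (hφ₀ : ∀ x y, inner ℝ (φ₀ x) (φ₀ y) = K₀ (x, y))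
    (hφ₁ : ∀ x y, inner ℝ (φ₁ x) (φ₁ y) = K₁ (x, y)) (ε : ℝ)
    (hG : hsSq e₁ (crossOp ρ φ₀ φ₁) ≠ ∞) :
    ∃ (ι : Type v) (b : HilbertBasis ι ℝ H₁) (a : ι → ℝ) (S : ℝ),
      (∀ j, (crossOp ρ φ₀ φ₁).adjoint (crossOp ρ φ₀ φ₁ (b j)) = a j • b j) ∧
      HasSum (fun j => scalarF (16 / ε ^ 2 * a j)) S ∧
      opW2 ε (covOp ρ K₀) (covOp ρ K₁)
        = ∫ x, K₀ (x, x) ∂ρ + ∫ x, K₁ (x, x) ∂ρ - ε / 2 * S := by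
  obtain ⟨hp, hR⟩ := posSqrt_covOp_spec ρ e₀ K₀ φ₀ hφ₀
  have h0 := covOp_eq_analysisOp_comp_adjoint ρ K₀ φ₀ hφ₀
  have h1 := covOp_eq_analysisOp_comp_adjoint ρ K₁ φ₁ hφ₁
  set R := posSqrt (covOp ρ K₀) with hRdef
  -- With R = K₀^{1/2} and analysis operators Sᵢ, Z = S₁*R gives Z*Z = R K₁ R and ZZ* = S₁*S₀S₀*S₁ =
  -- G*G.
  set Z : Lp ℝ 2 ρ →L[ℝ] H₁ := (analysisOp ρ φ₁).adjoint ∘L R with hZ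
  have hZa : Z.adjoint = R ∘L analysisOp ρ φ₁ := by
    rw [hZ, ContinuousLinearMap.adjoint_comp, ContinuousLinearMap.adjoint_adjoint,
      ContinuousLinearMap.isSelfAdjoint_iff'.1 hp.isSelfAdjoint]
  have hRR : ∀ g, R (R g) = analysisOp ρ φ₀ ((analysisOp ρ φ₀).adjoint g) := fun g => by
    have : R (R g) = (R * R) g := rfl
    rw [this, hR, h0]; rfl
  have hZZ : ∀ h, Z (Z.adjoint h) = (crossOp ρ φ₀ φ₁).adjoint (crossOp ρ φ₀ φ₁ h) := fun h => by
    rw [hZa, hZ, crossOp, ContinuousLinearMap.adjoint_comp, ContinuousLinearMap.adjoint_adjoint]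
    simp only [ContinuousLinearMap.comp_apply, hRR]
  have hZR : ∀ g, Z.adjoint (Z g) = R (covOp ρ K₁ (R g)) := fun g => by
    rw [hZa, hZ, h1]; rfl
  obtain ⟨w, c, -⟩ := exists_hilbertBasis ℝ (Lp ℝ 2 ρ)
  have hZfin : hsSq c Z ≠ ∞ := by
    rw [← hsSq_adjoint c e₁]
    convert hG using 1
    refine tsum_congr fun i => ?_
    rw [enorm_sq_eq_ofReal, enorm_sq_eq_ofReal, ← real_inner_self_eq_norm_sq,
      ← real_inner_self_eq_norm_sq, ContinuousLinearMap.adjoint_inner_left, hZZ,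
      ContinuousLinearMap.adjoint_inner_right]
  have hc : IsCompactOperator (Z.adjoint ∘L Z) :=
    (isCompactOperator_of_hsSq_ne_top c Z hZfin).clm_comp Z.adjoint
  obtain ⟨κ, b, a, h⟩ := exists_eigenbasis _ hc
    (ContinuousLinearMap.isPositive_adjoint_comp_self Z).isSymmetric
  have han := eigenvalue_adjoint_comp_self Z b a h
  have ha : ∀ i, 0 ≤ a i := fun i => by rw [han]; positivity
  have hs : Summable a := by
    have := (hasSum_norm_sq_of_hsSq_ne_top b Z (by rwa [hsSq_eq b c])).summable
    exact this.congr fun i => (han i).symm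
  have hc0 : ∀ i, 0 ≤ 16 / ε ^ 2 * a i := fun i => by have := ha i; positivity
  have hS : Summable fun i => scalarF (16 / ε ^ 2 * a i) :=
    Summable.of_nonneg_of_le (fun i => scalarF_nonneg (hc0 i)) (fun i => scalarF_le (hc0 i))
      ((hs.mul_left _).div_const _)
  obtain ⟨ι', b', a', hb', ht⟩ := exists_eigenbasis_comp_adjoint Z b a h
  refine ⟨ι', b', a', ∑' i, scalarF (16 / ε ^ 2 * a i), fun j => ?_, ?_, ?_⟩
  · rw [← hZZ, hb']
  · exact (ht (fun t => scalarF (16 / ε ^ 2 * t)) (by simp [scalarF_zero]) _).1 hS.hasSum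
  · rw [opW2_of_eigenbasis ε _ _ b a (fun i => by rw [← hRdef, ← hZR]; exact h i) ha hs hS.hasSum,
      opTrace_covOp ρ e₀ K₀ φ₀ hφ₀, opTrace_covOp ρ e₁ K₁ φ₁ hφ₁]

end Population

/-! ### Empirical distance through the empirical cross-covariance -/

section Empirical

universe v

variable {X : Type*} [TopologicalSpace X] {n : ℕ}
  {H₀ : Type*} {H₁ : Type v} [NormedAddCommGroup H₀] [InnerProductSpace ℝ H₀]
  [CompleteSpace H₀] [NormedAddCommGroup H₁] [InnerProductSpace ℝ H₁] [CompleteSpace H₁]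

/-- The empirical synthesis operator `v ↦ n^{-1/2} ∑ⱼ vⱼ φ(xⱼ)`. -/
noncomputable def sampleOp (φ : C(X, H₁)) (x : Fin n → X) : EuclideanSpace ℝ (Fin n) →L[ℝ] H₁ :=
  ∑ j, (innerSL ℝ (EuclideanSpace.single j (1 : ℝ))).smulRight ((√n)⁻¹ • φ (x j))

omit [CompleteSpace H₁] in
theorem sampleOp_apply (φ : C(X, H₁)) (x : Fin n → X) (v : EuclideanSpace ℝ (Fin n)) :
    sampleOp φ x v = ∑ j, v j • (√n)⁻¹ • φ (x j) := by
  simp [sampleOp, EuclideanSpace.inner_single_left]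

theorem adjoint_sampleOp_apply (φ : C(X, H₁)) (x : Fin n → X) (h : H₁) (j : Fin n) :
    (sampleOp φ x).adjoint h j = (√n)⁻¹ * inner ℝ (φ (x j)) h := by
  have h1 : (sampleOp φ x).adjoint h j
      = inner ℝ (EuclideanSpace.single j (1 : ℝ)) ((sampleOp φ x).adjoint h) := by
    simp [EuclideanSpace.inner_single_left]
  rw [h1, ContinuousLinearMap.adjoint_inner_right, sampleOp_apply, Finset.sum_eq_single j]
  · simp [real_inner_smul_left]
  · intro i _ hij
    simp [hij]
  · simp

/-- The empirical cross-covariance operator `h ↦ n⁻¹ ∑ⱼ ⟪φ₁(xⱼ), h⟫ φ₀(xⱼ)`. -/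
noncomputable def empCrossOp (φ₀ : C(X, H₀)) (φ₁ : C(X, H₁)) (x : Fin n → X) : H₁ →L[ℝ] H₀ :=
  sampleOp φ₀ x ∘L (sampleOp φ₁ x).adjoint

theorem inv_sqrt_mul_inv_sqrt (n : ℕ) : (√n)⁻¹ * (√n)⁻¹ = (1 / n : ℝ) := by
  rw [← mul_inv, Real.mul_self_sqrt (Nat.cast_nonneg n), one_div]

omit [CompleteSpace H₀] in
theorem empCrossOp_apply (φ₀ : C(X, H₀)) (φ₁ : C(X, H₁)) (x : Fin n → X) (h : H₁) :
    empCrossOp φ₀ φ₁ x h = (1 / n : ℝ) • ∑ j, inner ℝ (φ₁ (x j)) h • φ₀ (x j) := by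
  rw [empCrossOp, ContinuousLinearMap.comp_apply, sampleOp_apply, Finset.smul_sum]
  refine Finset.sum_congr rfl fun j _ => ?_
  rw [adjoint_sampleOp_apply, smul_smul, smul_smul, ← inv_sqrt_mul_inv_sqrt]
  congr 1
  ring

theorem adjoint_comp_sampleOp (K : C(X × X, ℝ)) (φ : C(X, H₁))
    (hφ : ∀ x y, inner ℝ (φ x) (φ y) = K (x, y)) (x : Fin n → X) (v : EuclideanSpace ℝ (Fin n)) :
    (sampleOp φ x).adjoint (sampleOp φ x v)
      = Matrix.toEuclideanCLM (𝕜 := ℝ) (empCov K x) v := by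
  ext i
  rw [adjoint_sampleOp_apply, sampleOp_apply, Matrix.ofLp_toEuclideanCLM, Matrix.mulVec,
    dotProduct, inner_sum, Finset.mul_sum]
  refine Finset.sum_congr rfl fun j _ => ?_
  rw [real_inner_smul_right, real_inner_smul_right, hφ, empCov, Matrix.of_apply,
    ← inv_sqrt_mul_inv_sqrt]
  ring

theorem empCov_posSemidef {K : C(X × X, ℝ)} (hK : IsCovarianceKernel K) (x : Fin n → X) :
    (empCov K x).PosSemidef := by
  have := (hK n x).smul (show (0 : ℝ) ≤ 1 / n by positivity)
  convert this using 1
  ext i j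
  simp [empCov]

/-- The empirical entropic distance in terms of the singular values of the empirical
cross-covariance operator. -/
theorem exists_eigenbasis_empW2 (K₀ K₁ : C(X × X, ℝ)) (hK₀ : IsCovarianceKernel K₀)
    (hK₁ : IsCovarianceKernel K₁) (φ₀ : C(X, H₀)) (φ₁ : C(X, H₁))
    (hφ₀ : ∀ x y, inner ℝ (φ₀ x) (φ₀ y) = K₀ (x, y))
    (hφ₁ : ∀ x y, inner ℝ (φ₁ x) (φ₁ y) = K₁ (x, y)) (ε : ℝ) (x : Fin n → X) :
    ∃ (ι : Type v) (b : HilbertBasis ι ℝ H₁) (a : ι → ℝ) (S : ℝ),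
      (∀ j, (empCrossOp φ₀ φ₁ x).adjoint (empCrossOp φ₀ φ₁ x (b j)) = a j • b j) ∧
      HasSum (fun j => scalarF (16 / ε ^ 2 * a j)) S ∧
      empW2 ε K₀ K₁ x = (1 / n : ℝ) * ∑ j, (K₀ (x j, x j) + K₁ (x j, x j)) - ε / 2 * S := by
  obtain ⟨Y, hY⟩ : ∃ Y : Matrix (Fin n) (Fin n) ℝ, empCov K₀ x = Y.transpose * Y := by
    open scoped MatrixOrder Matrix.Norms.L2Operator in
    obtain ⟨Y, hY⟩ := CStarAlgebra.nonneg_iff_eq_star_mul_self.1 (empCov_posSemidef hK₀ x).nonneg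
    exact ⟨Y, hY⟩
  have hB : (Y * empCov K₁ x * Y.transpose).PosSemidef :=
    (empCov_posSemidef hK₁ x).mul_mul_conjTranspose_same Y
  set L : Matrix (Fin n) (Fin n) ℝ → EuclideanSpace ℝ (Fin n) →L[ℝ] EuclideanSpace ℝ (Fin n) :=
    fun M => Matrix.toEuclideanCLM (𝕜 := ℝ) M with hL
  have hLmul : ∀ M N v, L (M * N) v = L M (L N v) := fun M N v => by
    simp only [hL, map_mul]; rfl
  have hLadj : (L Y.transpose).adjoint = L Y := by
    have h := map_star (Matrix.toEuclideanCLM (n := Fin n) (𝕜 := ℝ)) Y.transpose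
    rw [ContinuousLinearMap.star_eq_adjoint] at h
    simp only [hL]
    rw [← h]
    congr 1
  -- With sample operators Tᵢ and Σ₀ = YᵀY, this gives Z*Z = YΣ₁Yᵀ and ZZ* = T₁Σ₀T₁* = G_n*G_n,
  -- since Σ₀ = T₀*T₀.
  set Z : EuclideanSpace ℝ (Fin n) →L[ℝ] H₁ := sampleOp φ₁ x ∘L L Y.transpose with hZ
  have hZa : Z.adjoint = L Y ∘L (sampleOp φ₁ x).adjoint := by
    rw [hZ, ContinuousLinearMap.adjoint_comp, hLadj]
  have h1 : ∀ i, Z.adjoint (Z (hB.1.eigenvectorBasis.toHilbertBasis i))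
      = hB.1.eigenvalues i • hB.1.eigenvectorBasis.toHilbertBasis i := fun i => by
    rw [hZa, hZ]
    simp only [ContinuousLinearMap.comp_apply, OrthonormalBasis.coe_toHilbertBasis]
    rw [adjoint_comp_sampleOp K₁ φ₁ hφ₁, ← hLmul, ← hLmul]
    ext k
    exact congrFun (hB.1.mulVec_eigenvectorBasis i) k
  obtain ⟨ι, b, a, hb, ht⟩ := exists_eigenbasis_comp_adjoint Z _ _ h1
  refine ⟨ι, b, a, ∑ i, scalarF (16 / ε ^ 2 * hB.1.eigenvalues i), fun j => ?_, ?_, ?_⟩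
  · rw [← hb, hZa, hZ, empCrossOp, ContinuousLinearMap.adjoint_comp,
      ContinuousLinearMap.adjoint_adjoint]
    simp only [ContinuousLinearMap.comp_apply]
    rw [adjoint_comp_sampleOp K₀ φ₀ hφ₀, hY, ← hLmul]
  · exact (ht (fun t => scalarF (16 / ε ^ 2 * t)) (by simp [scalarF_zero]) _).1
      (hasSum_fintype _)
  · have htr : ∀ K : C(X × X, ℝ), (empCov K x).trace = (1 / n : ℝ) * ∑ j, K (x j, x j) := fun K => by
      simp [Matrix.trace, empCov, Finset.mul_sum]
    have hF := matF_smul_transpose_mul_mul Y _ hB (show 0 ≤ 16 / ε ^ 2 by positivity)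
    rw [← hY] at hF
    rw [empW2, hF, Matrix.trace_add, htr, htr, Finset.sum_add_distrib, mul_add]

end Empirical

/-! ### Hilbert–Schmidt operators as a Hilbert space of sequences -/

section Embedding

variable {X : Type*} {ι : Type*} {H₀ H₁ : Type*} [NormedAddCommGroup H₀]
  [InnerProductSpace ℝ H₀] [NormedAddCommGroup H₁] [InnerProductSpace ℝ H₁]

theorem memlp_inner_smul (e : HilbertBasis ι ℝ H₁) (u : H₀) (v : H₁) :
    Memℓp (fun k => inner ℝ (e k) v • u) 2 := by
  refine memℓp_gen ?_
  have := ((hasSum_inner_sq e v).mul_right (‖u‖ ^ 2)).summable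
  refine this.congr fun k => ?_
  simp [norm_smul, mul_pow]

/-- The rank-one operator `h ↦ ⟪v, h⟫ u` as an element of the space of Hilbert–Schmidt operators,
represented by its values on a Hilbert basis. -/
noncomputable def tensorVec (e : HilbertBasis ι ℝ H₁) (u : H₀) (v : H₁) :
    lp (fun _ : ι => H₀) 2 :=
  ⟨fun k => inner ℝ (e k) v • u, memlp_inner_smul e u v⟩

theorem inner_tensorVec (e : HilbertBasis ι ℝ H₁) (u u' : H₀) (v v' : H₁) :
    inner ℝ (tensorVec e u v) (tensorVec e u' v') = inner ℝ u u' * inner ℝ v v' := by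
  refine (lp.hasSum_inner _ _).unique ?_
  have := (e.hasSum_inner_mul_inner v v').mul_left (inner ℝ u u')
  refine this.congr_fun fun k => ?_
  simp only [tensorVec, real_inner_smul_left, real_inner_smul_right, real_inner_comm v]
  ring

theorem norm_tensorVec (e : HilbertBasis ι ℝ H₁) (u : H₀) (v : H₁) :
    ‖tensorVec e u v‖ = ‖u‖ * ‖v‖ := by
  rw [← sq_eq_sq₀ (norm_nonneg _) (by positivity), ← real_inner_self_eq_norm_sq, inner_tensorVec,
    real_inner_self_eq_norm_sq, real_inner_self_eq_norm_sq, mul_pow]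

theorem hsSq_eq_enorm_sq (e : HilbertBasis ι ℝ H₁) (T : H₁ →L[ℝ] H₀) (A : lp (fun _ : ι => H₀) 2)
    (h : ∀ k, T (e k) = A k) : hsSq e T = ENNReal.ofReal (‖A‖ ^ 2) := by
  have h1 := lp.hasSum_inner (𝕜 := ℝ) A A
  simp only [real_inner_self_eq_norm_sq] at h1
  rw [hsSq, ← h1.tsum_eq, ENNReal.ofReal_tsum_of_nonneg (fun _ => sq_nonneg _) h1.summable]
  simp_rw [h, enorm_sq_eq_ofReal]

variable [TopologicalSpace X]

/-- The product feature map `x ↦ φ₀(x) ⊗ φ₁(x)`. -/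
noncomputable def tensorFeature (e : HilbertBasis ι ℝ H₁) (φ₀ : C(X, H₀)) (φ₁ : C(X, H₁)) :
    C(X, lp (fun _ : ι => H₀) 2) where
  toFun x := tensorVec e (φ₀ x) (φ₁ x)
  continuous_toFun := by
    rw [continuous_iff_continuousAt]
    intro x
    rw [ContinuousAt, tendsto_iff_norm_sub_tendsto_zero]
    have h1 : ∀ y, ‖tensorVec e (φ₀ y) (φ₁ y) - tensorVec e (φ₀ x) (φ₁ x)‖
        = √((‖φ₀ y‖ * ‖φ₁ y‖) ^ 2 - 2 * (inner ℝ (φ₀ y) (φ₀ x) * inner ℝ (φ₁ y) (φ₁ x))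
          + (‖φ₀ x‖ * ‖φ₁ x‖) ^ 2) := fun y => by
      rw [← inner_tensorVec, ← norm_tensorVec e, ← norm_tensorVec e, ← norm_sub_sq_real,
        Real.sqrt_sq (norm_nonneg _)]
    simp_rw [h1]
    have h2 : Continuous fun y => √((‖φ₀ y‖ * ‖φ₁ y‖) ^ 2
        - 2 * (inner ℝ (φ₀ y) (φ₀ x) * inner ℝ (φ₁ y) (φ₁ x)) + (‖φ₀ x‖ * ‖φ₁ x‖) ^ 2) := by
      fun_prop
    have h3 := h2.tendsto x
    rwa [real_inner_self_eq_norm_sq, real_inner_self_eq_norm_sq,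
      show (‖φ₀ x‖ * ‖φ₁ x‖) ^ 2 - 2 * (‖φ₀ x‖ ^ 2 * ‖φ₁ x‖ ^ 2) + (‖φ₀ x‖ * ‖φ₁ x‖) ^ 2 = 0 by ring,
      Real.sqrt_zero] at h3

end Embedding

section CrossEmbedding

variable {X : Type*} [MetricSpace X] [CompactSpace X] [MeasurableSpace X] [BorelSpace X]
  (ρ : Measure X) [IsProbabilityMeasure ρ]
  {ι : Type*} {H₀ H₁ : Type*} [NormedAddCommGroup H₀] [InnerProductSpace ℝ H₀]
  [CompleteSpace H₀] [NormedAddCommGroup H₁] [InnerProductSpace ℝ H₁] [CompleteSpace H₁]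

omit [CompleteSpace H₁] in
-- Presents G as a Bochner mean in a Hilbert space, where Pinelis' inequality applies.
theorem crossOp_apply_basis (e : HilbertBasis ι ℝ H₁) (φ₀ : C(X, H₀)) (φ₁ : C(X, H₁)) (k : ι) :
    crossOp ρ φ₀ φ₁ (e k) = (∫ x, tensorFeature e φ₀ φ₁ x ∂ρ : lp (fun _ : ι => H₀) 2) k := by
  classical
  refine ext_inner_left ℝ fun u => ?_
  have hs : ∀ A : lp (fun _ : ι => H₀) 2,
      inner ℝ u (A k) = inner ℝ (lp.single 2 k u : lp (fun _ : ι => H₀) 2) A := fun A =>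
    (lp.inner_single_left (𝕜 := ℝ) (G := fun _ : ι => H₀) k u A).symm
  rw [hs, ← integral_inner (integrable_of_continuousMap ρ _), crossOp,
    ContinuousLinearMap.comp_apply, ContinuousLinearMap.adjoint_inner_right,
    inner_analysisOp_analysisOp]
  refine integral_congr_ae (.of_forall fun x => ?_)
  beta_reduce
  rw [← hs]
  simp only [tensorFeature, ContinuousMap.coe_mk, tensorVec, real_inner_smul_right]
  rw [real_inner_comm u, real_inner_comm (e k), mul_comm]

omit [CompactSpace X] [MeasurableSpace X] [BorelSpace X] [CompleteSpace H₀] in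
theorem empCrossOp_apply_basis {n : ℕ} (e : HilbertBasis ι ℝ H₁) (φ₀ : C(X, H₀)) (φ₁ : C(X, H₁))
    (x : Fin n → X) (k : ι) :
    empCrossOp φ₀ φ₁ x (e k)
      = ((1 / n : ℝ) • ∑ j, tensorFeature e φ₀ φ₁ (x j) : lp (fun _ : ι => H₀) 2) k := by
  rw [empCrossOp_apply, lp.coeFn_smul, Pi.smul_apply, lp.coeFn_sum, Finset.sum_apply]
  congr 1
  refine Finset.sum_congr rfl fun j _ => ?_
  simp only [tensorFeature, ContinuousMap.coe_mk, tensorVec]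
  rw [real_inner_comm]

end CrossEmbedding

/-! ### Stability and the final bound -/

section Main

theorem abs_le_kernelSup {X : Type*} [TopologicalSpace X] [CompactSpace X] (K : C(X × X, ℝ))
    (p : X × X) : |K p| ≤ kernelSup K :=
  le_ciSup (f := fun p => |K p|) ⟨‖K‖, by rintro _ ⟨q, rfl⟩; exact K.norm_coe_le_norm q⟩ p

theorem norm_sq_feature_le {X : Type*} [TopologicalSpace X] [CompactSpace X] {H : Type*}
    [NormedAddCommGroup H] [InnerProductSpace ℝ H] {K : C(X × X, ℝ)} {φ : C(X, H)}
    (hφ : ∀ x y, inner ℝ (φ x) (φ y) = K (x, y)) (x : X) : ‖φ x‖ ^ 2 ≤ kernelSup K := by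
  rw [← real_inner_self_eq_norm_sq, hφ]
  exact (le_abs_self _).trans (abs_le_kernelSup K _)

variable {X : Type*} [MetricSpace X] [CompactSpace X] [MeasurableSpace X] [BorelSpace X]
  (ρ : Measure X) [IsProbabilityMeasure ρ]
  {ι₀ ι₁ : Type*} {H₀ H₁ : Type*} [NormedAddCommGroup H₀] [InnerProductSpace ℝ H₀]
  [CompleteSpace H₀] [NormedAddCommGroup H₁] [InnerProductSpace ℝ H₁] [CompleteSpace H₁]

omit [MetricSpace X] [CompactSpace X] [BorelSpace X] in
theorem norm_integral_le_of_bound {E : Type*} [NormedAddCommGroup E] [NormedSpace ℝ E]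
    {f : X → E} {B : ℝ} (h : ∀ x, ‖f x‖ ≤ B) : ‖∫ x, f x ∂ρ‖ ≤ B := by
  simpa using norm_integral_le_of_norm_le_const (μ := ρ) (.of_forall h)

theorem norm_average_le {E : Type*} [NormedAddCommGroup E] [NormedSpace ℝ E] {n : ℕ} (hn : 1 ≤ n)
    {f : Fin n → E} {B : ℝ} (h : ∀ j, ‖f j‖ ≤ B) : ‖(1 / n : ℝ) • ∑ j, f j‖ ≤ B := by
  have hn0 : (0 : ℝ) < n := by exact_mod_cast hn
  rw [norm_smul, Real.norm_of_nonneg (by positivity)]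
  have h1 : ‖∑ j, f j‖ ≤ n * B := by
    simpa using norm_sum_le_of_le Finset.univ fun j _ => h j
  calc 1 / n * ‖∑ j, f j‖ ≤ 1 / n * (n * B) := by gcongr
    _ = B := by field_simp

/-- Deterministic stability of the entropic distance under replacing `ρ` by an empirical
measure. -/
theorem abs_opW2_sub_empW2_le [Countable ι₀] [Countable ι₁] (e₀ : HilbertBasis ι₀ ℝ H₀)
    (e₁ : HilbertBasis ι₁ ℝ H₁) (K₀ K₁ : C(X × X, ℝ)) (hK₀ : IsCovarianceKernel K₀)
    (hK₁ : IsCovarianceKernel K₁) (φ₀ : C(X, H₀)) (φ₁ : C(X, H₁))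
    (hφ₀ : ∀ x y, inner ℝ (φ₀ x) (φ₀ y) = K₀ (x, y))
    (hφ₁ : ∀ x y, inner ℝ (φ₁ x) (φ₁ y) = K₁ (x, y)) {ε : ℝ} (hε : 0 < ε) {B : ℝ} (hB : 0 ≤ B)
    (hΨ : ∀ x, ‖tensorFeature e₁ φ₀ φ₁ x‖ ≤ B) {n : ℕ} (hn : 1 ≤ n) (x : Fin n → X) :
    |opW2 ε (covOp ρ K₀) (covOp ρ K₁) - empW2 ε K₀ K₁ x|
      ≤ |(1 / n : ℝ) * ∑ j, (K₀ (x j, x j) + K₁ (x j, x j))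
          - ∫ x, (K₀ (x, x) + K₁ (x, x)) ∂ρ|
        + 4 / ε * B * ‖(1 / n : ℝ) • ∑ j, tensorFeature e₁ φ₀ φ₁ (x j)
          - ∫ x, tensorFeature e₁ φ₀ φ₁ x ∂ρ‖ := by
  set Ψ := tensorFeature e₁ φ₀ φ₁ with hΨdef
  have hG := hsSq_eq_enorm_sq e₁ (crossOp ρ φ₀ φ₁) _ (crossOp_apply_basis ρ e₁ φ₀ φ₁)
  have hGn := hsSq_eq_enorm_sq e₁ (empCrossOp φ₀ φ₁ x) _ (empCrossOp_apply_basis e₁ φ₀ φ₁ x)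
  rw [← hΨdef] at hG hGn
  set A := ∫ x, Ψ x ∂ρ with hA
  set An := (1 / n : ℝ) • ∑ j, Ψ (x j) with hAn
  have hD : hsSq e₁ (empCrossOp φ₀ φ₁ x - crossOp ρ φ₀ φ₁) = ENNReal.ofReal (‖An - A‖ ^ 2) :=
    hsSq_eq_enorm_sq e₁ _ _ fun k => by
      rw [sub_apply, crossOp_apply_basis, empCrossOp_apply_basis, lp.coeFn_sub, Pi.sub_apply]
  have hD' : hsSq e₁ (crossOp ρ φ₀ φ₁ - empCrossOp φ₀ φ₁ x) = ENNReal.ofReal (‖An - A‖ ^ 2) := by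
    rw [norm_sub_rev]
    exact hsSq_eq_enorm_sq e₁ _ _ fun k => by
      rw [sub_apply, crossOp_apply_basis, empCrossOp_apply_basis, lp.coeFn_sub, Pi.sub_apply]
  have hAB : ‖A‖ ≤ B := norm_integral_le_of_bound ρ hΨ
  have hAnB : ‖An‖ ≤ B := norm_average_le hn fun j => hΨ (x j)
  have hGB : hsSq e₁ (crossOp ρ φ₀ φ₁) ≤ ENNReal.ofReal (B ^ 2) := by
    rw [hG]; gcongr
  have hGnB : hsSq e₁ (empCrossOp φ₀ φ₁ x) ≤ ENNReal.ofReal (B ^ 2) := by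
    rw [hGn]; gcongr
  obtain ⟨κ, b, a, S, hb, hS, hW⟩ := exists_eigenbasis_opW2 ρ e₀ e₁ K₀ K₁ φ₀ φ₁ hφ₀ hφ₁ ε
    (by rw [hG]; finiteness)
  obtain ⟨κ', b', a', S', hb', hS', hW'⟩ :=
    exists_eigenbasis_empW2 K₀ K₁ hK₀ hK₁ φ₀ φ₁ hφ₀ hφ₁ ε x
  have hc : 0 ≤ 16 / ε ^ 2 := by positivity
  -- The Klein bound is one-sided; exchanging the two operators gives the other side.
  have h1 := hasSum_scalarF_le _ _ b b' a a' hb hb' hc hB (norm_nonneg (An - A))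
    (by rw [hsSq_eq b' e₁]; exact hGB) (by rw [hsSq_eq b' e₁]; exact hGnB)
    (by rw [hsSq_eq b' e₁, hD']) hS hS'
  have h2 := hasSum_scalarF_le _ _ b' b a' a hb' hb hc hB (norm_nonneg (An - A))
    (by rw [hsSq_eq b e₁]; exact hGnB) (by rw [hsSq_eq b e₁]; exact hGB)
    (by rw [hsSq_eq b e₁, hD]) hS' hS
  have h3 : |S' - S| ≤ 16 / ε ^ 2 / 4 * (2 * B * ‖An - A‖) :=
    abs_sub_le_iff.2 ⟨by linarith, by linarith⟩
  have h4 : ∫ x, (K₀ (x, x) + K₁ (x, x)) ∂ρ = ∫ x, K₀ (x, x) ∂ρ + ∫ x, K₁ (x, x) ∂ρ :=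
    integral_add (integrable_of_continuousMap ρ ⟨fun x => K₀ (x, x), by fun_prop⟩)
      (integrable_of_continuousMap ρ ⟨fun x => K₁ (x, x), by fun_prop⟩)
  rw [h4, hW, hW']
  set t := ∫ x, K₀ (x, x) ∂ρ + ∫ x, K₁ (x, x) ∂ρ
  set tn := (1 / n : ℝ) * ∑ j, (K₀ (x j, x j) + K₁ (x j, x j))
  calc |t - ε / 2 * S - (tn - ε / 2 * S')| = |-(tn - t) + ε / 2 * (S' - S)| := by
        congr 1; ring
    _ ≤ |tn - t| + ε / 2 * |S' - S| := by
        refine (abs_add_le _ _).trans ?_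
        rw [abs_neg, abs_mul, abs_of_pos (by positivity : 0 < ε / 2)]
    _ ≤ |tn - t| + ε / 2 * (16 / ε ^ 2 / 4 * (2 * B * ‖An - A‖)) := by gcongr
    _ = _ := by
        congr 1
        field_simp
        norm_num

/-- Concentration of the empirical mean of a bounded continuous vector-valued function. -/
theorem pi_norm_average_sub_integral_gt_le {E : Type*} [NormedAddCommGroup E]
    [InnerProductSpace ℝ E] [CompleteSpace E] (f : C(X, E)) {b : ℝ}
    (hb : ∀ x, ‖f x - ∫ y, f y ∂ρ‖ ≤ b) {n : ℕ} (hn : 1 ≤ n) {θ : ℝ} (hθ : 0 ≤ θ) :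
    (Measure.pi fun _ : Fin n => ρ)
        {x | b * √(2 * θ / n) < ‖(1 / n : ℝ) • ∑ j, f (x j) - ∫ y, f y ∂ρ‖}
      ≤ ENNReal.ofReal (2 * Real.exp (-θ)) := by
  have hn0 : (0 : ℝ) < n := by exact_mod_cast hn
  have hf := integrable_of_continuousMap ρ f
  have hm : StronglyMeasurable fun x => f x - ∫ y, f y ∂ρ :=
    Continuous.stronglyMeasurable (by fun_prop)
  refine (measure_mono fun x hx => ?_).trans (pi_norm_sum_gt_le ρ hm hb (by
    rw [integral_sub hf (integrable_const _)]; simp) n hn hθ)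
  have h1 : ∑ j, (f (x j) - ∫ y, f y ∂ρ)
      = (n : ℝ) • ((1 / n : ℝ) • ∑ j, f (x j) - ∫ y, f y ∂ρ) := by
    rw [Finset.sum_sub_distrib, smul_sub, smul_smul, mul_one_div_cancel hn0.ne', one_smul]
    simp [Nat.cast_smul_eq_nsmul]
  have h2 : √(2 * θ * n) = n * √(2 * θ / n) := by
    rw [show 2 * θ * n = n ^ 2 * (2 * θ / n) by field_simp, Real.sqrt_mul (by positivity),
      Real.sqrt_sq hn0.le]
  have hx' : b * √(2 * θ / n) < ‖(1 / n : ℝ) • ∑ j, f (x j) - ∫ y, f y ∂ρ‖ := hx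
  change b * √(2 * θ * n) < ‖∑ j, (f (x j) - ∫ y, f y ∂ρ)‖
  rw [h1, h2, norm_smul, Real.norm_of_nonneg hn0.le, mul_left_comm]
  exact mul_lt_mul_of_pos_left hx' hn0

/-- Here 8/ε comes from the stability factor 4B/ε times the range bound 2B, with B² = p. Since 2(u +
v)² ≤ 4u² + 4v², constants 4 and 256 would suffice. -/
theorem error_bound_le_sqrt {s p ε θ : ℝ} (n : ℕ) (hε : 0 < ε)
    (hθ : 0 ≤ θ) :
    s * √(2 * θ / n) + 8 / ε * p * √(2 * θ / n)
      ≤ √((72 * s ^ 2 + 288 * (ε ^ 2)⁻¹ * p ^ 2) * θ / n) := by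
  refine Real.le_sqrt_of_sq_le ?_
  rw [← add_mul, mul_pow, Real.sq_sqrt (by positivity)]
  have h : (s + 8 / ε * p) ^ 2 * 2 ≤ 72 * s ^ 2 + 288 * (ε ^ 2)⁻¹ * p ^ 2 := by
    have h1 : (ε ^ 2)⁻¹ * p ^ 2 = (p / ε) ^ 2 := by field_simp
    have h2 : 8 / ε * p = 8 * (p / ε) := by ring
    rw [mul_assoc 288, h1, h2]
    nlinarith [sq_nonneg (s - 8 * (p / ε)), sq_nonneg s, sq_nonneg (p / ε)]
  calc (s + 8 / ε * p) ^ 2 * (2 * θ / n) = (s + 8 / ε * p) ^ 2 * 2 * (θ / n) := by ring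
    _ ≤ (72 * s ^ 2 + 288 * (ε ^ 2)⁻¹ * p ^ 2) * (θ / n) := by gcongr
    _ = _ := by ring

/-- The concentration bound for i.i.d. samples, on the product space. -/
theorem pi_abs_opW2_sub_empW2_gt_le (K₀ K₁ : C(X × X, ℝ)) (hK₀ : IsCovarianceKernel K₀)
    (hK₁ : IsCovarianceKernel K₁) {ε : ℝ} (hε : 0 < ε) {n : ℕ} (hn : 1 ≤ n) {θ : ℝ}
    (hθ : 0 ≤ θ) :
    (Measure.pi fun _ : Fin n => ρ)
        {x | √((72 * (kernelSup K₀ + kernelSup K₁) ^ 2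
          + 288 * (ε ^ 2)⁻¹ * kernelSup K₀ ^ 2 * kernelSup K₁ ^ 2) * θ / n)
          < |opW2 ε (covOp ρ K₀) (covOp ρ K₁) - empW2 ε K₀ K₁ x|}
      ≤ ENNReal.ofReal (4 * Real.exp (-θ)) := by
  obtain ⟨H₀, _, _, _, ι₀, _, e₀, φ₀, hφ₀⟩ := exists_feature_hilbertSpace K₀ hK₀
  obtain ⟨H₁, _, _, _, ι₁, _, e₁, φ₁, hφ₁⟩ := exists_feature_hilbertSpace K₁ hK₁
  have hX : Nonempty X := ρ.nonempty_of_neZero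
  have hk₀ : 0 ≤ kernelSup K₀ := (abs_nonneg _).trans (abs_le_kernelSup K₀ (hX.some, hX.some))
  have hk₁ : 0 ≤ kernelSup K₁ := (abs_nonneg _).trans (abs_le_kernelSup K₁ (hX.some, hX.some))
  set B := √(kernelSup K₀ * kernelSup K₁) with hB
  have hB2 : B * B = kernelSup K₀ * kernelSup K₁ := Real.mul_self_sqrt (by positivity)
  have hΨ : ∀ x, ‖tensorFeature e₁ φ₀ φ₁ x‖ ≤ B := fun x => by
    refine Real.le_sqrt_of_sq_le ?_
    rw [show tensorFeature e₁ φ₀ φ₁ x = tensorVec e₁ (φ₀ x) (φ₁ x) from rfl, norm_tensorVec, mul_pow]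
    gcongr
    · exact norm_sq_feature_le hφ₀ x
    · exact norm_sq_feature_le hφ₁ x
  have hΨc : ∀ x, ‖tensorFeature e₁ φ₀ φ₁ x - ∫ y, tensorFeature e₁ φ₀ φ₁ y ∂ρ‖ ≤ 2 * B := fun x =>
    (norm_sub_le _ _).trans (by
      have := norm_integral_le_of_bound ρ hΨ
      linarith [hΨ x])
  let t : C(X, ℝ) := ⟨fun x => K₀ (x, x) + K₁ (x, x), by fun_prop⟩
  have ht0 : ∀ x, 0 ≤ t x := fun x => by
    change 0 ≤ K₀ (x, x) + K₁ (x, x)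
    rw [← hφ₀, ← hφ₁]
    exact add_nonneg real_inner_self_nonneg real_inner_self_nonneg
  have ht1 : ∀ x, t x ≤ kernelSup K₀ + kernelSup K₁ := fun x =>
    add_le_add ((le_abs_self _).trans (abs_le_kernelSup K₀ _))
      ((le_abs_self _).trans (abs_le_kernelSup K₁ _))
  -- Both t and its mean lie in [0, κ₀ + κ₁], so no factor 2 is lost.
  have htc : ∀ x, ‖t x - ∫ y, t y ∂ρ‖ ≤ kernelSup K₀ + kernelSup K₁ := fun x => by
    have h1 : 0 ≤ ∫ y, t y ∂ρ := integral_nonneg ht0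
    have h2 : ∫ y, t y ∂ρ ≤ kernelSup K₀ + kernelSup K₁ := by
      simpa using integral_mono (integrable_of_continuousMap ρ t) (integrable_const _) ht1
    rw [Real.norm_eq_abs, abs_le]
    constructor <;> linarith [ht0 x, ht1 x]
  have hbad₁ := pi_norm_average_sub_integral_gt_le ρ t htc hn hθ
  have hbad₂ := pi_norm_average_sub_integral_gt_le ρ (tensorFeature e₁ φ₀ φ₁) hΨc hn hθ
  refine (measure_mono fun x hx => ?_).trans ((measure_union_le _ _).trans
    ((add_le_add hbad₁ hbad₂).trans (le_of_eq ?_)))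
  · by_contra hx'
    rw [Set.mem_union, not_or] at hx'
    obtain ⟨h1, h2⟩ := hx'
    simp only [Set.mem_ofPred_eq, not_lt] at h1 h2
    have h3 := abs_opW2_sub_empW2_le ρ e₀ e₁ K₀ K₁ hK₀ hK₁ φ₀ φ₁ hφ₀ hφ₁ hε
      (Real.sqrt_nonneg _) hΨ hn x
    refine absurd hx (not_lt.2 (h3.trans ((add_le_add h1 (mul_le_mul_of_nonneg_left h2
      (by positivity))).trans ?_)))
    have h4 := error_bound_le_sqrt (s := kernelSup K₀ + kernelSup K₁)
      (p := kernelSup K₀ * kernelSup K₁) n hε hθ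
    rw [mul_pow, ← mul_assoc (288 * (ε ^ 2)⁻¹), ← hB2] at h4
    refine le_trans (le_of_eq ?_) h4
    ring
  · rw [← ENNReal.ofReal_add (by positivity) (by positivity)]
    congr 1
    ring

end Main

end EntropicGP

theorem mainTheorem4 {d : ℕ} (X : Set (EuclideanSpace ℝ (Fin d))) [CompactSpace X]
    (ρ : MeasureTheory.Measure X) [MeasureTheory.IsProbabilityMeasure ρ]
    (K₀ K₁ : C(X × X, ℝ))
    (hK₀ : EntropicGP.IsCovarianceKernel K₀) (hK₁ : EntropicGP.IsCovarianceKernel K₁)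
    (ε : ℝ) (hε : 0 < ε) (n : ℕ) (hn : 1 ≤ n)
    {Ω : Type*} [MeasurableSpace Ω] (P : MeasureTheory.Measure Ω)
    [MeasureTheory.IsProbabilityMeasure P]
    (x : Fin n → Ω → X) (hx_meas : ∀ k, Measurable (x k))
    (hx_indep : ProbabilityTheory.iIndepFun x P)
    (hx_law : ∀ k, P.map (x k) = ρ)
    (θ : ℝ) (hθ : 0 ≤ θ) :
    1 - 6 * Real.exp (-θ) ≤
      P.real {ω | |EntropicGP.opW2 ε (EntropicGP.covOp ρ K₀) (EntropicGP.covOp ρ K₁)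
            - EntropicGP.empW2 ε K₀ K₁ (fun k => x k ω)|
          ≤ Real.sqrt ((72 * (EntropicGP.kernelSup K₀ + EntropicGP.kernelSup K₁) ^ 2
              + 288 * (ε ^ 2)⁻¹ * EntropicGP.kernelSup K₀ ^ 2 * EntropicGP.kernelSup K₁ ^ 2)
              * θ / n)} := by
  have hmeas : Measurable fun ω k => x k ω := measurable_pi_lambda _ hx_meas
  have hmap : P.map (fun ω k => x k ω) = MeasureTheory.Measure.pi fun _ : Fin n => ρ := by
    rw [(ProbabilityTheory.iIndepFun_iff_map_fun_eq_pi_map fun k => (hx_meas k).aemeasurable).1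
      hx_indep]
    simp_rw [hx_law]
  have hbad := EntropicGP.pi_abs_opW2_sub_empW2_gt_le ρ K₀ K₁ hK₀ hK₁ hε hn hθ
  rw [← hmap] at hbad
  -- This inequality for the preimage needs no measurability of the bad event; subadditivity below
  -- likewise avoids it for `good`.
  have hbad' := (MeasureTheory.Measure.le_map_apply hmeas.aemeasurable _).trans hbad
  set good : Set Ω := {ω | |EntropicGP.opW2 ε (EntropicGP.covOp ρ K₀) (EntropicGP.covOp ρ K₁)
            - EntropicGP.empW2 ε K₀ K₁ (fun k => x k ω)|
          ≤ Real.sqrt ((72 * (EntropicGP.kernelSup K₀ + EntropicGP.kernelSup K₁) ^ 2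
              + 288 * (ε ^ 2)⁻¹ * EntropicGP.kernelSup K₀ ^ 2 * EntropicGP.kernelSup K₁ ^ 2)
              * θ / n)} with hgood
  have hcompl : P.real goodᶜ ≤ 4 * Real.exp (-θ) := by
    refine ENNReal.toReal_le_of_le_ofReal (by positivity)
      (le_trans (MeasureTheory.measure_mono ?_) hbad')
    intro ω hω
    simp only [hgood, Set.mem_compl_iff, Set.mem_ofPred_eq, not_le] at hω
    exact hω
  have hunion := MeasureTheory.measureReal_union_le (μ := P) good goodᶜ
  rw [Set.union_compl_self, MeasureTheory.probReal_univ] at hunion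
  linarith [Real.exp_pos (-θ)]
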